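/- A *parametric timed automaton* (PTA) over a finite set $C$ of clocks and a finite set $P$ of parameters is a tuple $A=(\Sigma,L,\ell_0,F,I,\to)$ with a finite alphabet $\Sigma$, a finite set $L$ of locations, an initial location $\ell_0\in L$, a set $F\subseteq L$ of accepting locations, a function $I$ that assigns to every location an invariant, and a finite set $\to$ of transitions $\ell\xrightarrow{g,a,R}\ell'$ with a guard $g$, a letter $a\in\Sigma$ and a set $R\subseteq C$ of clocks to be reset. Guards are finite conjunctions of constraints $x\bowtie c$ with $x\in C$, $c\in\mathbb N_0\cup P$ and $\bowtie\ \in\{<,\le,=,\ge,>\}$; invariants are such conjunctions with $\bowtie\ \in\{<,\le\}$ only. A clock is *parametric* if some guard or invariant compares it to a parameter. Let the time domain $\mathbb T$ be $\mathbb R_{\ge0}$ (continuous-time semantics) or $\mathbb N_0$ (discrete-time semantics). For a parameter valuation $\gamma:P\to\mathbb N_0$, the states are the pairs $(\ell,\nu)$ with $\nu:C\to\mathbb T$ satisfying $I(\ell)$ under $\gamma$; between states there are delay steps $(\ell,\nu)\xrightarrow{d}(\ell,\nu+d)$, $d\in\mathbb T$, and action steps $(\ell,\nu)\xrightarrow{a}(\ell',\nu')$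 for transitions $\ell\xrightarrow{g,a,R}\ell'$ such that $\nu,\gamma\models g$, where $\nu'$ is $\nu$ with the clocks in $R$ set to $0$. The timed language $L_\gamma(A)$ is the set of timed words $(a_0,d_0)\cdots(a_n,d_n)$, $n\ge0$, for which there is a computation $(\ell_0,0)\xrightarrow{d_0}\cdot\xrightarrow{a_0}\cdots\xrightarrow{d_n}\cdot\xrightarrow{a_n}(\ell_{n+1},\nu_{n+1})$ with $\ell_{n+1}\in F$. The *reachability problem* asks, given $A$, whether $L_\gamma(A)\neq\emptyset$ for some $\gamma$; the *safety problem* asks, given $A$, whether $L_\gamma(A)=\emptyset$ for some $\gamma$. **Theorem.** For PTA with one (nonnegative integer valued) parameter and exactly three clocks, all three of them parametric, the reachability problem and the safety problem are both undecidable, in the continuous-time semantics as well as in the discrete-time semantics. All four problems remain undecidable when the input is moreover restricted to PTA without invariants (every invariant is the empty conjunction) and with a one-letter alphabet. -/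

import Mathlib

/-! # Parametric timed automata over nonnegative integer parameters

`k` is the number of clocks and `m` the number of parameters; the clocks are the elements of
`Fin k` and the parameters the elements of `Fin m`. -/

/-! ## Syntax -/

/-- The comparison operators `<`, `≤`, `=`, `≥`, `>`. -/
inductive Cmp : Type
  | lt | le | eq | ge | gt
  deriving DecidableEq

/-- A simple clock constraint `x ⋈ c`, where `c` is a natural number or a parameter. -/
structure ClockConstraint (k m : ℕ) : Type where
  clock : Fin k
  op : Cmp
  bound : ℕ ⊕ Fin m

/-- A guard: a conjunction of simple clock constraints, given by the list of its conjuncts. -/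
abbrev Guard (k m : ℕ) : Type := List (ClockConstraint k m)

/-- A transition `(ℓ, g, a, R, ℓ')`; the set `R` of clocks to be reset is given by a list. -/
structure Transition (k m : ℕ) : Type where
  source : ℕ
  guard : Guard k m
  letter : ℕ
  reset : List (Fin k)
  target : ℕ

/-- The raw finite description of a parametric timed automaton: the alphabet is
`{0, …, numLetters - 1}`, the set of locations is `{0, …, numLocs - 1}`, `init` is the initial
location, `final` lists the accepting locations, the `ℓ`-th entry of `invariants` is the
invariant of the location `ℓ`, and `transitions` lists the transitions. -/
structure RawPTA (k m : ℕ) : Type where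
  numLetters : ℕ
  numLocs : ℕ
  init : ℕ
  final : List ℕ
  invariants : List (Guard k m)
  transitions : List (Transition k m)

/-- The description is meaningful: all locations and letters mentioned are in range, every
location has an invariant, and invariants only contain upper bounds on clocks. -/
def RawPTA.WellFormed {k m : ℕ} (A : RawPTA k m) : Prop :=
  A.init < A.numLocs ∧
  (∀ l ∈ A.final, l < A.numLocs) ∧
  A.invariants.length = A.numLocs ∧
  (∀ J ∈ A.invariants, ∀ c ∈ J, c.op = Cmp.lt ∨ c.op = Cmp.le) ∧
  (∀ t ∈ A.transitions, t.source < A.numLocs ∧ t.letter < A.numLetters ∧ t.target < A.numLocs)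

/-- Parametric timed automata with `k` clocks and `m` parameters. -/
abbrev PTA (k m : ℕ) : Type := {A : RawPTA k m // A.WellFormed}

/-- The simple clock constraint `c` compares the clock `x` to a parameter. -/
def ClockConstraint.IsParametricOn {k m : ℕ} (c : ClockConstraint k m) (x : Fin k) : Prop :=
  c.clock = x ∧ ∃ p : Fin m, c.bound = Sum.inr p

namespace PTA

/-- The clock `x` is parametric in `A`: a guard or an invariant of `A` compares it to a
parameter. -/
def IsParametric {k m : ℕ} (A : PTA k m) (x : Fin k) : Prop :=
  (∃ t ∈ A.1.transitions, ∃ c ∈ t.guard, c.IsParametricOn x) ∨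
  (∃ J ∈ A.1.invariants, ∃ c ∈ J, c.IsParametricOn x)

/-- All clocks of `A` are parametric, i.e. there are no nonparametric clocks. -/
def AllParametric {k m : ℕ} (A : PTA k m) : Prop := ∀ x : Fin k, A.IsParametric x

/-- `A` has no invariants (all of them are empty conjunctions) and a one-letter alphabet. -/
def IsPlain {k m : ℕ} (A : PTA k m) : Prop :=
  (∀ J ∈ A.1.invariants, J = []) ∧ A.1.numLetters = 1

/-- The invariant of the location `l`. -/
def invariant {k m : ℕ} (A : PTA k m) (l : ℕ) : Guard k m := A.1.invariants.getD l []

end PTA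

/-! ## Semantics

`T` is the time domain: `NNReal` for the continuous-time semantics, and `ℕ` for the
discrete-time semantics, in which all delays (hence all clock values) are natural numbers. -/

section Semantics

variable {k m : ℕ} {T : Type} [Semiring T] [LinearOrder T]

def Cmp.Holds (op : Cmp) (a b : T) : Prop :=
  match op with
  | .lt => a < b
  | .le => a ≤ b
  | .eq => a = b
  | .ge => a ≥ b
  | .gt => a > b

/-- The natural number denoted by a bound under the parameter valuation `γ`. -/
def boundValue (γ : Fin m → ℕ) (b : ℕ ⊕ Fin m) : ℕ := Sum.elim id γ b

/-- `ν, γ ⊨ g`. -/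
def Guard.Sat (ν : Fin k → T) (γ : Fin m → ℕ) (g : Guard k m) : Prop :=
  ∀ c ∈ g, c.op.Holds (ν c.clock) (boundValue γ c.bound : T)

/-- A configuration: a location and a clock valuation. -/
structure Config (k : ℕ) (T : Type) : Type where
  loc : ℕ
  val : Fin k → T

namespace PTA

/-- The states of the timed transition system under `γ`: the configurations that satisfy the
invariant of their location. -/
def IsState (A : PTA k m) (γ : Fin m → ℕ) (s : Config k T) : Prop :=
  s.loc < A.1.numLocs ∧ Guard.Sat s.val γ (A.invariant s.loc)

/-- The delay step `s → s'` of duration `d`. -/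
def DelayStep (A : PTA k m) (γ : Fin m → ℕ) (d : T) (s s' : Config k T) : Prop :=
  A.IsState γ s ∧ A.IsState γ s' ∧ s'.loc = s.loc ∧ ∀ x, s'.val x = s.val x + d

/-- The action step `s → s'` with label `a`. -/
def ActionStep (A : PTA k m) (γ : Fin m → ℕ) (a : ℕ) (s s' : Config k T) : Prop :=
  A.IsState γ s ∧ A.IsState γ s' ∧
  ∃ t ∈ A.1.transitions, t.source = s.loc ∧ t.letter = a ∧ t.target = s'.loc ∧
    Guard.Sat s.val γ t.guard ∧ ∀ x, s'.val x = if x ∈ t.reset then 0 else s.val x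

/-- `A.Run γ s w s'`: there is a computation from `s` to `s'` reading the timed word
`w = (a₀, d₀) (a₁, d₁) …`, in which the delay `dᵢ` precedes the action `aᵢ`. -/
inductive Run (A : PTA k m) (γ : Fin m → ℕ) :
    Config k T → List (ℕ × T) → Config k T → Prop
  | nil (s : Config k T) : Run A γ s [] s
  | cons {s s₁ s₂ s₃ : Config k T} {a : ℕ} {d : T} {w : List (ℕ × T)} :
      A.DelayStep γ d s s₁ → A.ActionStep γ a s₁ s₂ → Run A γ s₂ w s₃ →
      Run A γ s ((a, d) :: w) s₃

/-- The initial configuration: the initial location with all clocks zero. -/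
def initConfig (A : PTA k m) (T : Type) [Semiring T] : Config k T := ⟨A.1.init, fun _ => 0⟩

/-- The timed language of `A` under `γ`: all timed words `(a₀, d₀) … (aₙ, dₙ)`, `n ≥ 0`, read by a
computation from the initial configuration to an accepting location. -/
def language (A : PTA k m) (T : Type) [Semiring T] [LinearOrder T] (γ : Fin m → ℕ) :
    Set (List (ℕ × T)) :=
  {w | w ≠ [] ∧ ∃ s : Config k T, s.loc ∈ A.1.final ∧ A.Run γ (A.initConfig T) w s}

/-- The reachability problem: some parameter valuation makes the timed language nonempty. -/
def Reachability (A : PTA k m) (T : Type) [Semiring T] [LinearOrder T] : Prop :=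
  ∃ γ : Fin m → ℕ, (A.language T γ).Nonempty

/-- The safety problem: some parameter valuation makes the timed language empty. -/
def Safety (A : PTA k m) (T : Type) [Semiring T] [LinearOrder T] : Prop :=
  ∃ γ : Fin m → ℕ, A.language T γ = ∅

end PTA

end Semantics

/-! ## Automata as inputs of algorithms

The evident encodings: a structure is encoded as the tuple of its fields. -/

def Cmp.equivFin : Cmp ≃ Fin 5 where
  toFun op := match op with
    | .lt => 0
    | .le => 1
    | .eq => 2
    | .ge => 3
    | .gt => 4
  invFun i := match i with
    | 0 => .lt
    | 1 => .le
    | 2 => .eq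
    | 3 => .ge
    | 4 => .gt
  left_inv op := by cases op <;> rfl
  right_inv i := by fin_cases i <;> rfl

def ClockConstraint.equivProd (k m : ℕ) :
    ClockConstraint k m ≃ Fin k × Cmp × (ℕ ⊕ Fin m) where
  toFun c := (c.clock, c.op, c.bound)
  invFun c := ⟨c.1, c.2.1, c.2.2⟩
  left_inv _ := rfl
  right_inv _ := rfl

def Transition.equivProd (k m : ℕ) :
    Transition k m ≃ ℕ × Guard k m × ℕ × List (Fin k) × ℕ where
  toFun t := (t.source, t.guard, t.letter, t.reset, t.target)
  invFun t := ⟨t.1, t.2.1, t.2.2.1, t.2.2.2.1, t.2.2.2.2⟩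
  left_inv _ := rfl
  right_inv _ := rfl

def RawPTA.equivProd (k m : ℕ) :
    RawPTA k m ≃ ℕ × ℕ × ℕ × List ℕ × List (Guard k m) × List (Transition k m) where
  toFun A := (A.numLetters, A.numLocs, A.init, A.final, A.invariants, A.transitions)
  invFun A := ⟨A.1, A.2.1, A.2.2.1, A.2.2.2.1, A.2.2.2.2.1, A.2.2.2.2.2⟩
  left_inv _ := rfl
  right_inv _ := rfl

instance : Primcodable Cmp := Primcodable.ofEquiv _ Cmp.equivFin

instance (k m : ℕ) : Primcodable (ClockConstraint k m) :=
  Primcodable.ofEquiv _ (ClockConstraint.equivProd k m)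

instance (k m : ℕ) : Primcodable (Transition k m) :=
  Primcodable.ofEquiv _ (Transition.equivProd k m)

instance (k m : ℕ) : Primcodable (RawPTA k m) :=
  Primcodable.ofEquiv _ (RawPTA.equivProd k m)

section Primrec

variable {k m : ℕ}

theorem ClockConstraint.primrec_equivProd : Primrec (ClockConstraint.equivProd k m) :=
  Primrec.of_equiv

theorem Transition.primrec_equivProd : Primrec (Transition.equivProd k m) :=
  Primrec.of_equiv

theorem RawPTA.primrec_equivProd : Primrec (RawPTA.equivProd k m) :=
  Primrec.of_equiv

theorem ClockConstraint.primrec_clock : Primrec (ClockConstraint.clock (k := k) (m := m)) :=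
  Primrec.fst.comp primrec_equivProd

theorem ClockConstraint.primrec_op : Primrec (ClockConstraint.op (k := k) (m := m)) :=
  (Primrec.fst.comp Primrec.snd).comp primrec_equivProd

theorem ClockConstraint.primrec_bound : Primrec (ClockConstraint.bound (k := k) (m := m)) :=
  (Primrec.snd.comp Primrec.snd).comp primrec_equivProd

theorem Transition.primrec_source : Primrec (Transition.source (k := k) (m := m)) :=
  Primrec.fst.comp primrec_equivProd

theorem Transition.primrec_guard : Primrec (Transition.guard (k := k) (m := m)) :=
  (Primrec.fst.comp Primrec.snd).comp primrec_equivProd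

theorem Transition.primrec_letter : Primrec (Transition.letter (k := k) (m := m)) :=
  (Primrec.fst.comp (Primrec.snd.comp Primrec.snd)).comp primrec_equivProd

theorem Transition.primrec_target : Primrec (Transition.target (k := k) (m := m)) :=
  (Primrec.snd.comp (Primrec.snd.comp (Primrec.snd.comp Primrec.snd))).comp primrec_equivProd

theorem RawPTA.primrec_numLetters : Primrec (RawPTA.numLetters (k := k) (m := m)) :=
  Primrec.fst.comp primrec_equivProd

theorem RawPTA.primrec_numLocs : Primrec (RawPTA.numLocs (k := k) (m := m)) :=
  (Primrec.fst.comp Primrec.snd).comp primrec_equivProd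

theorem RawPTA.primrec_init : Primrec (RawPTA.init (k := k) (m := m)) :=
  (Primrec.fst.comp (Primrec.snd.comp Primrec.snd)).comp primrec_equivProd

theorem RawPTA.primrec_final : Primrec (RawPTA.final (k := k) (m := m)) :=
  (Primrec.fst.comp (Primrec.snd.comp (Primrec.snd.comp Primrec.snd))).comp primrec_equivProd

theorem RawPTA.primrec_invariants : Primrec (RawPTA.invariants (k := k) (m := m)) :=
  (Primrec.fst.comp (Primrec.snd.comp (Primrec.snd.comp (Primrec.snd.comp Primrec.snd)))).comp
    primrec_equivProd

theorem RawPTA.primrec_transitions : Primrec (RawPTA.transitions (k := k) (m := m)) :=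
  (Primrec.snd.comp (Primrec.snd.comp (Primrec.snd.comp (Primrec.snd.comp Primrec.snd)))).comp
    primrec_equivProd

theorem RawPTA.primrecPred_wellFormed : PrimrecPred (RawPTA.WellFormed (k := k) (m := m)) := by
  have hlt : PrimrecRel fun (a b : ℕ) => a < b := Primrec.nat_lt
  have h1 : PrimrecPred fun A : RawPTA k m => A.init < A.numLocs :=
    hlt.comp primrec_init primrec_numLocs
  have h2 : PrimrecPred fun A : RawPTA k m => ∀ l ∈ A.final, l < A.numLocs :=
    hlt.forall_mem_list.comp primrec_final primrec_numLocs
  have h3 : PrimrecPred fun A : RawPTA k m => A.invariants.length = A.numLocs :=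
    Primrec.eq.comp (Primrec.list_length.comp primrec_invariants) primrec_numLocs
  have hop : PrimrecPred fun c : ClockConstraint k m => c.op = Cmp.lt ∨ c.op = Cmp.le :=
    (Primrec.eq.comp ClockConstraint.primrec_op (Primrec.const _)).or
      (Primrec.eq.comp ClockConstraint.primrec_op (Primrec.const _))
  have h4 : PrimrecPred fun A : RawPTA k m =>
      ∀ J ∈ A.invariants, ∀ c ∈ J, c.op = Cmp.lt ∨ c.op = Cmp.le :=
    hop.forall_mem_list.forall_mem_list.comp primrec_invariants
  have ht : PrimrecRel fun (t : Transition k m) (A : RawPTA k m) =>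
      t.source < A.numLocs ∧ t.letter < A.numLetters ∧ t.target < A.numLocs :=
    (hlt.comp (Transition.primrec_source.comp Primrec.fst)
      (primrec_numLocs.comp Primrec.snd)).and
    ((hlt.comp (Transition.primrec_letter.comp Primrec.fst)
      (primrec_numLetters.comp Primrec.snd)).and
    (hlt.comp (Transition.primrec_target.comp Primrec.fst)
      (primrec_numLocs.comp Primrec.snd)))
  have h5 : PrimrecPred fun A : RawPTA k m => ∀ t ∈ A.transitions,
      t.source < A.numLocs ∧ t.letter < A.numLetters ∧ t.target < A.numLocs :=
    ht.forall_mem_list.comp primrec_transitions Primrec.id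
  exact h1.and (h2.and (h3.and (h4.and h5)))

instance RawPTA.decidablePredWellFormed : DecidablePred (RawPTA.WellFormed (k := k) (m := m)) :=
  fun A => by unfold RawPTA.WellFormed; infer_instance

instance PTA.primcodable (k m : ℕ) : Primcodable (PTA k m) :=
  Primcodable.subtype RawPTA.primrecPred_wellFormed

theorem PTA.primrec_val : Primrec (Subtype.val : PTA k m → RawPTA k m) :=
  Primrec.subtype_val (hp := RawPTA.primrecPred_wellFormed)

theorem ClockConstraint.primrecRel_isParametricOn :
    PrimrecRel (ClockConstraint.IsParametricOn (k := k) (m := m)) := by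
  have hb : PrimrecPred fun b : ℕ ⊕ Fin m => ∃ p : Fin m, b = Sum.inr p := by
    have : Primrec fun b : ℕ ⊕ Fin m => Sum.casesOn (motive := fun _ => Bool) b
        (fun _ => false) (fun _ => true) :=
      Primrec.sumCasesOn Primrec.id (Primrec.const false).to₂ (Primrec.const true).to₂
    refine (Primrec.eq.comp this (Primrec.const true)).of_eq ?_
    rintro (n | p) <;> simp
  exact (Primrec.eq.comp (primrec_clock.comp Primrec.fst) Primrec.snd).and
    (hb.comp (primrec_bound.comp Primrec.fst))

theorem PTA.primrecPred_allParametric : PrimrecPred (PTA.AllParametric (k := k) (m := m)) := by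
  have hc := (ClockConstraint.primrecRel_isParametricOn (k := k) (m := m)).exists_mem_list
  have ht : PrimrecRel fun (t : Transition k m) (x : Fin k) =>
      ∃ c ∈ t.guard, c.IsParametricOn x :=
    hc.comp (Transition.primrec_guard.comp Primrec.fst) Primrec.snd
  have hx : PrimrecRel fun (x : Fin k) (A : PTA k m) => A.IsParametric x :=
    (ht.exists_mem_list.comp
      (RawPTA.primrec_transitions.comp (PTA.primrec_val.comp Primrec.snd)) Primrec.fst).or
    (hc.exists_mem_list.comp
      (RawPTA.primrec_invariants.comp (PTA.primrec_val.comp Primrec.snd)) Primrec.fst)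
  refine (hx.forall_mem_list.comp (Primrec.const (List.finRange k)) Primrec.id).of_eq ?_
  intro A
  simp [PTA.AllParametric]

theorem PTA.primrecPred_isPlain : PrimrecPred (PTA.IsPlain (k := k) (m := m)) := by
  have hJ : PrimrecPred fun J : Guard k m => J = [] := by
    refine (Primrec.eq.comp Primrec.list_length (Primrec.const 0)).of_eq ?_
    intro J
    simp
  exact (hJ.forall_mem_list.comp (RawPTA.primrec_invariants.comp PTA.primrec_val)).and
    (Primrec.eq.comp (RawPTA.primrec_numLetters.comp PTA.primrec_val) (Primrec.const 1))

end Primrec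

/-- The automata with one parameter and exactly three clocks, all of which are parametric. -/
abbrev ThreeClockPTA : Type := {A : PTA 3 1 // A.AllParametric}

/-- Those which moreover have no invariants and a one-letter alphabet. -/
abbrev PlainThreeClockPTA : Type := {A : PTA 3 1 // A.AllParametric ∧ A.IsPlain}

noncomputable instance : DecidablePred (PTA.AllParametric (k := 3) (m := 1)) :=
  fun _ => Classical.dec _

noncomputable instance :
    DecidablePred fun A : PTA 3 1 => A.AllParametric ∧ A.IsPlain :=
  fun _ => Classical.dec _

noncomputable instance : Primcodable ThreeClockPTA :=
  Primcodable.subtype PTA.primrecPred_allParametric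

noncomputable instance : Primcodable PlainThreeClockPTA :=
  Primcodable.subtype (PTA.primrecPred_allParametric.and PTA.primrecPred_isPlain)

/-! Halting of two-counter machines is reduced to both problems. Clocks 0 and 1 carry the counters
and clock 2 is the reference: in a control location, counter `r` is the difference between clock `r`
and clock 2.

Let `p` be the value of the parameter. An instruction is simulated by a cycle between two moments at
which clock 2 is zero. In the cycle each clock is either reset once, when it equals `p` (`short`),
or first when it equals `p` and then when it equals 1 (`long`). The resets subtract `p` or `p + 1`
from a clock. If only clock `r` is short, its difference from clock 2 grows by 1; if only clock `r`
is long, it drops by 1. The resets may interleave in any order: a clock minus what its pending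
resets will still subtract changes only by the elapsed time, so the differences of these quantities
are conserved. This is `SimInv`, and it makes every continuous-time run sound (`simInv_of_reach`). A
decrement of zero cannot complete its cycle, since its clock would end at -1.

Conversely, as long as the counters are at most `p`, each step has an integral schedule
(`reach_of_cycle`, `reach_of_step`). If a counter exceeds `p`, an edge leads to the location
`overflow`. Soundness in continuous time and completeness in discrete time cover both semantics at
once, because discrete runs are continuous runs.

A halting machine has bounded counters. With the halting exit accepting, some `p` gives a nonempty
language iff the machine halts. With `overflow` accepting, some `p` gives an empty language iff the
counters are bounded. For the two conditions to agree, the machine must have unbounded counters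
whenever it does not halt. `exists_search_machine` provides this: it searches for a zero of a
primitive recursive function, and the Gödel number in its first counter grows with the candidate.
The input enters only as the constant in the guard of the first transition. -/

/-! ## Two-counter machines -/

/-- An instruction of a two-counter machine with jump targets in `A`: increment a counter, or
decrement a counter if it is positive and jump according to whether it was positive. -/
inductive CounterInstr (A : Type) : Type
  | inc (r : Fin 2) (next : A)
  | dec (r : Fin 2) (pos zero : A)

namespace CounterInstr

variable {A B : Type}

def map (f : A → B) : CounterInstr A → CounterInstr B
  | inc r a => inc r (f a)
  | dec r a b => dec r (f a) (f b)

/-- The effect of an instruction on the two counters, and the chosen jump target. -/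
def exec : CounterInstr A → (Fin 2 → ℕ) → A × (Fin 2 → ℕ)
  | inc r a, s => (a, Function.update s r (s r + 1))
  | dec r a b, s => if s r = 0 then (b, s) else (a, Function.update s r (s r - 1))

theorem exec_map (f : A → B) (I : CounterInstr A) (s : Fin 2 → ℕ) :
    (I.map f).exec s = (f (I.exec s).1, (I.exec s).2) := by
  cases I with
  | inc r a => rfl
  | dec r a b => simp only [map, exec]; split_ifs <;> rfl

end CounterInstr

/-- A two-counter machine with control states `Q` and exits `E`. -/
abbrev CounterMachine (Q E : Type) : Type := Q → CounterInstr (Q ⊕ E)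

namespace CounterMachine

variable {Q E Q' E' : Type}

def Step (M : CounterMachine Q E) (c d : (Q ⊕ E) × (Fin 2 → ℕ)) : Prop :=
  ∃ q, c.1 = Sum.inl q ∧ d = (M q).exec c.2

def Reaches (M : CounterMachine Q E) :
    (Q ⊕ E) × (Fin 2 → ℕ) → (Q ⊕ E) × (Fin 2 → ℕ) → Prop :=
  Relation.ReflTransGen M.Step

theorem Step.eq {M : CounterMachine Q E} {c d d' : (Q ⊕ E) × (Fin 2 → ℕ)}
    (h : M.Step c d) (h' : M.Step c d') : d = d' := by
  obtain ⟨q, hq, rfl⟩ := h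
  obtain ⟨q', hq', rfl⟩ := h'
  obtain rfl := Sum.inl_injective (hq.symm.trans hq')
  rfl

/-- This is the tool for gluing: computations survive when a machine is embedded into a larger one
and its exits are redirected. -/
theorem Reaches.lift {M : CounterMachine Q E} {M' : CounterMachine Q' E'} (f : Q ⊕ E → Q' ⊕ E')
    (g : Q → Q') (hf : ∀ q, f (Sum.inl q) = Sum.inl (g q))
    (hM : ∀ q, M' (g q) = (M q).map f) {c d : (Q ⊕ E) × (Fin 2 → ℕ)} (h : M.Reaches c d) :
    M'.Reaches (f c.1, c.2) (f d.1, d.2) := by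
  refine Relation.ReflTransGen.lift (fun c : (Q ⊕ E) × (Fin 2 → ℕ) => (f c.1, c.2)) ?_ _ _ h
  rintro ⟨_, s⟩ _ ⟨q, rfl, rfl⟩
  exact ⟨g q, hf q, by rw [hM, CounterInstr.exec_map]⟩

/-- A machine that reaches an exit only visits boundedly large counter values. -/
theorem Reaches.exists_bound {M : CounterMachine Q E} {c : (Q ⊕ E) × (Fin 2 → ℕ)} {e : E}
    {s : Fin 2 → ℕ} (h : M.Reaches c (Sum.inr e, s)) :
    ∃ B : ℕ, ∀ d, M.Reaches c d → ∀ r, d.2 r ≤ B := by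
  induction h using Relation.ReflTransGen.head_induction_on with
  | refl =>
    refine ⟨∑ r, s r, fun d hd r => ?_⟩
    rcases Relation.ReflTransGen.cases_head hd with rfl | ⟨_, ⟨q, hq, _⟩, _⟩
    · exact Finset.single_le_sum (f := s) (fun _ _ => Nat.zero_le _) (Finset.mem_univ r)
    · cases hq
  | @head a b hab _ ih =>
    obtain ⟨B, hB⟩ := ih
    refine ⟨B + ∑ r, a.2 r, fun d hd r => ?_⟩
    rcases Relation.ReflTransGen.cases_head hd with rfl | ⟨b', hb', hd'⟩
    · exact (Finset.single_le_sum (f := a.2) (fun _ _ => Nat.zero_le _)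
        (Finset.mem_univ r)).trans (Nat.le_add_left _ _)
    -- By determinism, every proper continuation from `a` passes through the next configuration of
    -- the halting computation.
    · rw [← hab.eq hb'] at hd'
      exact (hB d hd' r).trans (Nat.le_add_right _ _)

/-! ### Composition of machine fragments -/

/-- Some finite two-counter machine transforms inputs into outputs at least as prescribed by the
relation `R` on a state space `S`, whose elements are represented by counter values. -/
def Impl {S : Type} (enc : S → Fin 2 → ℕ) (R : S → E × S → Prop) : Prop :=
  ∃ (Q : Type) (_ : Finite Q) (M : CounterMachine Q E) (q₀ : Q),
    ∀ s x, R s x → M.Reaches (Sum.inl q₀, enc s) (Sum.inr x.1, enc x.2)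

namespace Impl

variable {S : Type} {enc : S → Fin 2 → ℕ}

theorem mono {R R' : S → E × S → Prop} (h : Impl enc R') (hR : ∀ s x, R s x → R' s x) :
    Impl enc R := by
  obtain ⟨Q, hQ, M, q, hM⟩ := h
  exact ⟨Q, hQ, M, q, fun s x hx => hM s x (hR s x hx)⟩

theorem pullback {S' : Type} {enc' : S' → Fin 2 → ℕ} {R : S → E × S → Prop}
    {R' : S' → E × S' → Prop} (h : Impl enc R) (f : S' → S)
    (hf : ∀ s, enc' s = enc (f s)) (hR : ∀ s x, R' s x → R (f s) (x.1, f x.2)) :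
    Impl enc' R' := by
  obtain ⟨Q, hQ, M, q, hM⟩ := h
  exact ⟨Q, hQ, M, q, fun s x hx => by simpa only [hf] using hM _ _ (hR s x hx)⟩

theorem instr (I : CounterInstr E) :
    Impl (fun s => s) fun (s : Fin 2 → ℕ) (x : E × (Fin 2 → ℕ)) => x = I.exec s := by
  refine ⟨Unit, inferInstance, fun _ => I.map Sum.inr, (), ?_⟩
  rintro s _ rfl
  refine Relation.ReflTransGen.single ⟨(), rfl, ?_⟩
  rw [CounterInstr.exec_map]

theorem pure (e : E) : Impl enc fun s x => x = (e, s) := by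
  -- An entry is a control state and must execute something; an increment undone by a decrement
  -- leaves the store unchanged.
  refine ⟨Bool, inferInstance, fun b => if b then .dec 0 (Sum.inr e) (Sum.inr e)
    else .inc 0 (Sum.inl true), false, ?_⟩
  rintro s _ rfl
  refine Relation.ReflTransGen.head ⟨false, rfl, rfl⟩
    (Relation.ReflTransGen.single ⟨true, rfl, ?_⟩)
  simp [CounterInstr.exec]

/-- Each exit `e` of the first machine is wired to the entry of its own second machine, so an exit
acts as finite memory kept in the control state. -/
theorem bind [Finite E] {R : S → E × S → Prop} {R' : E → S → E' × S → Prop}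
    (h : Impl enc R) (h' : ∀ e, Impl enc (R' e)) :
    Impl enc fun s x => ∃ y, R s y ∧ R' y.1 y.2 x := by
  obtain ⟨Q, hQ, M, q, hM⟩ := h
  choose Q' hQ' M' q' hM' using h'
  let f : Q ⊕ E → (Q ⊕ Σ e, Q' e) ⊕ E' :=
    Sum.elim (fun p => Sum.inl (Sum.inl p)) fun e => Sum.inl (Sum.inr ⟨e, q' e⟩)
  let f' (e : E) : Q' e ⊕ E' → (Q ⊕ Σ e, Q' e) ⊕ E' := Sum.map (fun p => Sum.inr ⟨e, p⟩) id
  let N : CounterMachine (Q ⊕ Σ e, Q' e) E' :=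
    Sum.elim (fun p => (M p).map f) fun p => (M' p.1 p.2).map (f' p.1)
  refine ⟨_, inferInstance, N, Sum.inl q, ?_⟩
  rintro s x ⟨y, hy, hx⟩
  have h₁ := Reaches.lift (M' := N) f Sum.inl (fun _ => rfl) (fun _ => rfl) (hM s y hy)
  have h₂ := Reaches.lift (M' := N) (f' y.1) (fun p => Sum.inr ⟨y.1, p⟩) (fun _ => rfl)
    (fun _ => rfl) (hM' y.1 y.2 x hx)
  exact h₁.trans h₂

/-- Repetition: the exit `none` of the body leads back to its entry. -/
theorem exists_loop {R : S → Option E × S → Prop} (h : Impl enc R) :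
    ∃ (Q : Type) (_ : Finite Q) (M : CounterMachine Q E) (q₀ : Q),
      (∀ s t, R s (none, t) → M.Reaches (Sum.inl q₀, enc s) (Sum.inl q₀, enc t)) ∧
      ∀ s e t, R s (some e, t) → M.Reaches (Sum.inl q₀, enc s) (Sum.inr e, enc t) := by
  obtain ⟨Q, hQ, M, q, hM⟩ := h
  let f : Q ⊕ Option E → Q ⊕ E := Sum.elim Sum.inl fun o => o.elim (Sum.inl q) Sum.inr
  let M' : CounterMachine Q E := fun p => (M p).map f
  have hl := fun c d h => Reaches.lift (M := M) (M' := M') (c := c) (d := d) f id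
    (fun _ => rfl) (fun _ => rfl) h
  exact ⟨Q, hQ, M', q, fun s t hst => hl _ _ (hM s _ hst), fun s e t hst => hl _ _ (hM s _ hst)⟩

/-- The sequence `a` lists the stores at the successive entries into the body. -/
theorem loop {R : S → Option E × S → Prop} (h : Impl enc R) :
    Impl enc fun s x => ∃ (n : ℕ) (a : ℕ → S), s = a 0 ∧ (∀ i < n, R (a i) (none, a (i + 1))) ∧
      R (a n) (some x.1, x.2) := by
  obtain ⟨Q, hQ, M, q, h1, h2⟩ := h.exists_loop
  refine ⟨Q, hQ, M, q, ?_⟩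
  rintro _ ⟨e, t⟩ ⟨n, a, rfl, ha, hn⟩
  refine Relation.ReflTransGen.trans ?_ (h2 _ e t hn)
  clear hn
  induction n with
  | zero => exact Relation.ReflTransGen.refl
  | succ n ih => exact (ih fun i hi => ha i (by omega)).trans (h1 _ _ (ha n (by omega)))

/-- Sequential composition. -/
theorem seq {R : S → Unit × S → Prop} {R' : S → E × S → Prop} (h : Impl enc R)
    (h' : Impl enc R') : Impl enc fun s x => ∃ t, R s ((), t) ∧ R' t x :=
  (h.bind fun _ => h').mono fun _ _ ⟨t, ht⟩ => ⟨((), t), ht⟩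

/-- While the test succeeds, execute the body. -/
theorem whileTrue {T : S → Bool × S → Prop} {R : S → Unit × S → Prop} (h : Impl enc T)
    (h' : Impl enc R) :
    Impl enc fun s (x : Unit × S) => ∃ (n : ℕ) (a : ℕ → S), s = a 0 ∧
      (∀ i < n, ∃ t, T (a i) (true, t) ∧ R t ((), a (i + 1))) ∧ T (a n) (false, x.2) := by
  have hb : Impl enc fun s (x : Option Unit × S) => ∃ y, T s y ∧
      (bif y.1 then (∃ t, R y.2 ((), t) ∧ x = (none, t)) else x = (some (), y.2)) :=
    h.bind (R' := fun b s (x : Option Unit × S) =>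
      bif b then (∃ t, R s ((), t) ∧ x = (none, t)) else x = (some (), s)) fun b => match b with
      | true => h'.seq (Impl.pure none)
      | false => Impl.pure (some ())
  refine hb.loop.mono ?_
  rintro s ⟨⟨⟩, t⟩ ⟨n, a, hs, ha, hn⟩
  refine ⟨n, a, hs, fun i hi => ?_, (false, t), hn, rfl⟩
  obtain ⟨t, ht, ht'⟩ := ha i hi
  exact ⟨(true, t), ht, _, ht', rfl⟩

end Impl

/-! ### Arithmetic on a pair of counters -/

def pairStore (s : ℕ × ℕ) : Fin 2 → ℕ := ![s.1, s.2]

theorem impl_incFst : Impl pairStore fun s (x : Unit × _) => x.2 = (s.1 + 1, s.2) := by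
  refine (Impl.instr (.inc 0 ())).pullback pairStore (fun _ => rfl) ?_
  rintro s ⟨_, _⟩ rfl
  refine Prod.ext rfl (funext fun i => ?_)
  fin_cases i <;> rfl

theorem impl_incSnd : Impl pairStore fun s (x : Unit × _) => x.2 = (s.1, s.2 + 1) := by
  refine (Impl.instr (.inc 1 ())).pullback pairStore (fun _ => rfl) ?_
  rintro s ⟨_, _⟩ rfl
  refine Prod.ext rfl (funext fun i => ?_)
  fin_cases i <;> rfl

theorem impl_decFst : Impl pairStore fun s (x : Bool × _) =>
    (s.1 = 0 ∧ x = (false, s)) ∨ s.1 = x.2.1 + 1 ∧ s.2 = x.2.2 ∧ x.1 = true := by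
  refine (Impl.instr (.dec 0 true false)).pullback pairStore (fun _ => rfl) ?_
  rintro ⟨a, b⟩ ⟨e, c, d⟩ (⟨rfl : a = 0, h⟩ | ⟨rfl : a = c + 1, rfl : b = d, rfl : e = true⟩)
  · cases h; rfl
  · refine Prod.ext rfl (funext fun i => ?_)
    fin_cases i <;> rfl

theorem impl_decSnd : Impl pairStore fun s (x : Bool × _) =>
    (s.2 = 0 ∧ x = (false, s)) ∨ s.1 = x.2.1 ∧ s.2 = x.2.2 + 1 ∧ x.1 = true := by
  refine (Impl.instr (.dec 1 true false)).pullback pairStore (fun _ => rfl) ?_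
  rintro ⟨a, b⟩ ⟨e, c, d⟩ (⟨rfl : b = 0, h⟩ | ⟨rfl : a = c, rfl : b = d + 1, rfl : e = true⟩)
  · cases h; rfl
  · refine Prod.ext rfl (funext fun i => ?_)
    fin_cases i <;> rfl

theorem impl_addFst (k : ℕ) :
    Impl pairStore fun s (x : Unit × _) => x.2 = (s.1 + k, s.2) := by
  induction k with
  | zero => exact (Impl.pure ()).mono fun s x h => Prod.ext rfl h
  | succ k ih => exact (ih.seq impl_incFst).mono fun s x h => ⟨_, rfl, h⟩

theorem impl_addSnd (k : ℕ) :
    Impl pairStore fun s (x : Unit × _) => x.2 = (s.1, s.2 + k) := by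
  induction k with
  | zero => exact (Impl.pure ()).mono fun s x h => Prod.ext rfl h
  | succ k ih => exact (ih.seq impl_incSnd).mono fun s x h => ⟨_, rfl, h⟩

theorem impl_moveFst (k : ℕ) :
    Impl pairStore fun s (x : Unit × _) => x.2 = (0, s.2 + s.1 * k) := by
  refine (impl_decFst.whileTrue (impl_addSnd k)).mono ?_
  rintro ⟨a, b⟩ ⟨_, _⟩ rfl
  refine ⟨a, fun i => (a - i, b + i * k), by simp, fun i hi => ⟨(a - (i + 1), b + i * k), ?_, ?_⟩,
    Or.inl ⟨by simp, by simp⟩⟩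
  · exact Or.inr ⟨by simp only; omega, rfl, rfl⟩
  · simp only [Prod.mk.injEq, true_and]; ring

theorem impl_moveSnd (k : ℕ) :
    Impl pairStore fun s (x : Unit × _) => x.2 = (s.1 + s.2 * k, 0) := by
  refine (impl_decSnd.whileTrue (impl_addFst k)).mono ?_
  rintro ⟨a, b⟩ ⟨_, _⟩ rfl
  refine ⟨b, fun i => (a + i * k, b - i), by simp, fun i hi => ⟨(a + i * k, b - (i + 1)), ?_, ?_⟩,
    Or.inl ⟨by simp, by simp⟩⟩
  · exact Or.inr ⟨rfl, by simp only; omega, rfl⟩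
  · simp only [Prod.mk.injEq, and_true]; ring

theorem impl_mul (k : ℕ) :
    Impl pairStore fun s (x : Unit × _) => s.2 = 0 ∧ x.2 = (s.1 * k, 0) := by
  refine ((impl_moveFst k).seq (impl_moveSnd 1)).mono ?_
  rintro ⟨a, _⟩ ⟨_, _⟩ ⟨rfl, rfl⟩
  exact ⟨_, rfl, by simp⟩

/-- Subtract `d` from the first counter (exit `none`), or, if it is `j < d`, clear it and
exit with `j`. -/
theorem impl_subFst (d : ℕ) : Impl pairStore fun s (x : Option (Fin d) × _) =>
    s.2 = x.2.2 ∧ ((s.1 = x.2.1 + d ∧ x.1 = none) ∨ x.2.1 = 0 ∧ ∃ j, x.1 = some j ∧ s.1 = j) := by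
  induction d with
  | zero =>
    refine (Impl.pure none).mono ?_
    rintro ⟨a, b⟩ ⟨_, c, e⟩ ⟨rfl, ⟨h, rfl⟩ | ⟨h, j, _⟩⟩
    · simp_all
    · exact j.elim0
  | succ d ih =>
    -- After `d` successful decrements one more is tried; if it fails, the counter was exactly `d`,
    -- the new possible remainder.
    have h : Impl pairStore fun s (x : Option (Fin (d + 1)) × _) => ∃ y : Option (Fin d) × (ℕ × ℕ),
        (s.2 = y.2.2 ∧ ((s.1 = y.2.1 + d ∧ y.1 = none) ∨
          y.2.1 = 0 ∧ ∃ j, y.1 = some j ∧ s.1 = j)) ∧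
        y.1.elim (∃ z : Bool × (ℕ × ℕ), ((y.2.1 = 0 ∧ z = (false, y.2)) ∨
          y.2.1 = z.2.1 + 1 ∧ y.2.2 = z.2.2 ∧ z.1 = true) ∧
          x = ((bif z.1 then none else some (Fin.last d)), z.2))
          (fun j => x = (some j.castSucc, y.2)) :=
      ih.bind (R' := fun o s x => o.elim
        (∃ y, ((s.1 = 0 ∧ y = (false, s)) ∨ s.1 = y.2.1 + 1 ∧ s.2 = y.2.2 ∧ y.1 = true) ∧
          x = ((bif y.1 then none else some (Fin.last d)), y.2))
        (fun j => x = (some j.castSucc, s))) fun o => match o with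
      | none => impl_decFst.bind fun b => Impl.pure (bif b then none else some (Fin.last d))
      | some j => Impl.pure (some j.castSucc)
    refine h.mono ?_
    rintro ⟨a, b⟩ ⟨o, c, e⟩ ⟨rfl, ⟨h, rfl⟩ | ⟨h, j, rfl, rfl⟩⟩
    · simp only at h
      refine ⟨(none, c + 1, b), ⟨rfl, Or.inl ⟨by simp only; omega, rfl⟩⟩, (true, c, b),
        Or.inr ⟨rfl, rfl, rfl⟩, rfl⟩
    · simp only at h
      subst h
      induction j using Fin.lastCases with
      | last =>
        exact ⟨(none, 0, b), ⟨rfl, Or.inl ⟨by simp, rfl⟩⟩, (false, 0, b), Or.inl ⟨rfl, rfl⟩, rfl⟩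
      | cast j => exact ⟨(some j, 0, b), ⟨rfl, Or.inr ⟨rfl, j, rfl, rfl⟩⟩, rfl⟩

/-- Divide the first counter by `d` if it is a multiple of `d`. -/
theorem impl_div (d : ℕ) (hd : 0 < d) : Impl pairStore fun s (x : Bool × _) => s.2 = 0 ∧
    x.2.2 = 0 ∧ ((s.1 = x.2.1 * d ∧ x.1 = true) ∨ ¬ d ∣ s.1 ∧ x.2.1 = s.1 ∧ x.1 = false) := by
  have hb : Impl pairStore fun s (x : Option (Fin d) × _) => ∃ y : Option (Fin d) × (ℕ × ℕ),
      (s.2 = y.2.2 ∧ ((s.1 = y.2.1 + d ∧ y.1 = none) ∨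
        y.2.1 = 0 ∧ ∃ j, y.1 = some j ∧ s.1 = j)) ∧
      y.1.elim (∃ t, t = (y.2.1, y.2.2 + 1) ∧ x = (none, t)) (fun j => x = (some j, y.2)) :=
    (impl_subFst d).bind (R' := fun o s (x : Option (Fin d) × _) => o.elim
      (∃ t, t = (s.1, s.2 + 1) ∧ x = (none, t)) (fun j => x = (some j, s))) fun o => match o with
      | none => impl_incSnd.seq (Impl.pure none)
      | some j => Impl.pure (some j)
  have hb' : Impl pairStore fun s (x : Option (Fin d) × _) =>
      (x.1 = none ∧ x.2.2 = s.2 + 1 ∧ s.1 = x.2.1 + d) ∨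
      (∃ j, x.1 = some j ∧ s.1 = j ∧ x.2 = (0, s.2)) := by
    refine hb.mono ?_
    rintro ⟨a, b⟩ ⟨o, c, e⟩ (⟨rfl, h, h'⟩ | ⟨j, rfl, h, h'⟩)
    · exact ⟨(none, c, b), ⟨rfl, Or.inl ⟨h', rfl⟩⟩, _, rfl, by simp_all⟩
    · cases h'
      exact ⟨(some j, 0, b), ⟨rfl, Or.inr ⟨rfl, j, rfl, h⟩⟩, rfl⟩
  -- The second counter now holds the quotient and the exit the remainder. With remainder 0 the
  -- quotient is moved back as it is; otherwise it is multiplied by `d` and the remainder added,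
  -- which restores the dividend.
  have hl := hb'.loop.bind (R' := fun (o : Fin d) s (x : Bool × _) =>
      ∃ t, t = (s.1 + s.2 * (if o.1 = 0 then 1 else d), 0) ∧
        ∃ t', t' = (t.1 + o, t.2) ∧ x = (decide (o.1 = 0), t'))
    fun o => (impl_moveSnd (if o.1 = 0 then 1 else d)).seq
      ((impl_addFst o.1).seq (Impl.pure (decide (o.1 = 0))))
  refine hl.mono ?_
  rintro ⟨a, _⟩ ⟨o, c, _⟩ ⟨rfl, rfl, h⟩
  refine ⟨((⟨a % d, Nat.mod_lt _ hd⟩ : Fin d), 0, a / d), ⟨a / d, fun i => (a - i * d, i),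
    by simp, fun i hi => Or.inl ⟨rfl, rfl, ?_⟩, Or.inr ⟨_, rfl, ?_, rfl⟩⟩, ?_⟩
  · have : (i + 1) * d ≤ a := (Nat.mul_le_mul_right d hi).trans (Nat.div_mul_le_self a d)
    simp only
    rw [Nat.succ_mul] at *
    omega
  · have := Nat.div_add_mod' a d
    simp only
    omega
  · rcases h with ⟨h, h'⟩ | ⟨h, h', h''⟩
    · simp only at h h'
      subst h h'
      refine ⟨_, rfl, _, rfl, ?_⟩
      simp [hd]
    · simp only at h h' h''
      subst h' h''
      refine ⟨_, rfl, _, rfl, ?_⟩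
      have h0 : c % d ≠ 0 := fun h0 => h (Nat.dvd_of_mod_eq_zero h0)
      simp [h0, Nat.div_add_mod']

end CounterMachine

/-! ### Gödel numbering of registers -/

namespace CounterMachine

open Finsupp

/-- The number that codes the contents of infinitely many registers. -/
noncomputable def regCode (σ : ℕ →₀ ℕ) : ℕ := σ.prod fun r e => Nat.nth Nat.Prime r ^ e

/-- The second counter is the workspace of multiplication and division and is empty between register
operations. -/
noncomputable def regStore (σ : ℕ →₀ ℕ) : Fin 2 → ℕ := pairStore (regCode σ, 0)

theorem regCode_single (r n : ℕ) : regCode (single r n) = Nat.nth Nat.Prime r ^ n :=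
  Finsupp.prod_single_index (pow_zero _)

theorem regCode_add (σ τ : ℕ →₀ ℕ) : regCode (σ + τ) = regCode σ * regCode τ :=
  Finsupp.prod_add_index' (fun _ => pow_zero _) fun _ _ _ => pow_add _ _ _

theorem regCode_pos (σ : ℕ →₀ ℕ) : 0 < regCode σ :=
  Finset.prod_pos fun r _ => Nat.pow_pos (Nat.prime_nth_prime r).pos

theorem not_dvd_regCode {σ : ℕ →₀ ℕ} {r : ℕ} (h : σ r = 0) :
    ¬ Nat.nth Nat.Prime r ∣ regCode σ := by
  intro hd
  obtain ⟨s, hs, hd⟩ := (Nat.prime_nth_prime r).prime.exists_mem_finset_dvd hd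
  have := (Nat.prime_dvd_prime_iff_eq (Nat.prime_nth_prime r) (Nat.prime_nth_prime s)).1
    ((Nat.prime_nth_prime r).dvd_of_dvd_pow hd)
  obtain rfl := Nat.nth_injective Nat.infinite_setOfPred_prime this
  exact Finsupp.mem_support_iff.1 hs h

theorem impl_incReg (r : ℕ) :
    Impl regStore fun σ (x : Unit × _) => x.2 = σ + single r 1 := by
  refine (impl_mul (Nat.nth Nat.Prime r)).pullback (fun σ => (regCode σ, 0)) (fun _ => rfl) ?_
  rintro σ ⟨_, _⟩ rfl
  refine ⟨rfl, ?_⟩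
  simp [regCode_add, regCode_single]

/-- Decrementing is division by the `r`-th prime; the register is zero exactly if that prime does
not divide the code. -/
theorem impl_decReg (r : ℕ) : Impl regStore fun σ (x : Bool × _) =>
    (σ r = 0 ∧ x = (false, σ)) ∨ σ = x.2 + single r 1 ∧ x.1 = true := by
  refine (impl_div _ (Nat.prime_nth_prime r).pos).pullback (fun σ => (regCode σ, 0))
    (fun _ => rfl) ?_
  rintro σ ⟨e, τ⟩ (⟨h, h'⟩ | ⟨rfl, h⟩)
  · cases h'
    exact ⟨rfl, rfl, Or.inr ⟨not_dvd_regCode h, rfl, rfl⟩⟩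
  · refine ⟨rfl, rfl, Or.inl ⟨?_, h⟩⟩
    simp [regCode_add, regCode_single]

theorem impl_addReg (δ : ℕ →₀ ℕ) : Impl regStore fun σ (x : Unit × _) => x.2 = σ + δ := by
  induction δ using Finsupp.induction_linear with
  | zero => exact (Impl.pure ()).mono fun s x h => Prod.ext rfl (by simpa using h)
  | add δ δ' h h' => exact (h.seq h').mono fun σ x hx => ⟨_, rfl, by rw [hx, add_assoc]⟩
  | single r n =>
    induction n with
    | zero => exact (Impl.pure ()).mono fun s x h => Prod.ext rfl (by simpa using h)
    | succ n ih =>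
      exact (ih.seq (impl_incReg r)).mono fun σ x hx => ⟨_, rfl, by
        rw [hx, single_add, add_assoc]⟩

/-- Clear the register `r` and add the multiple of `δ` given by its former content. -/
theorem impl_drainReg (r : ℕ) (δ : ℕ →₀ ℕ) (hδ : δ r = 0) :
    Impl regStore fun σ (x : Unit × _) => x.2 = σ.erase r + σ r • δ := by
  refine ((impl_decReg r).whileTrue (impl_addReg δ)).mono ?_
  rintro σ ⟨_, _⟩ rfl
  refine ⟨σ r, fun i => σ.erase r + i • δ + single r (σ r - i), ?_, fun i hi => ?_, ?_⟩
  · simp [Finsupp.erase_add_single]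
  · refine ⟨σ.erase r + i • δ + single r (σ r - (i + 1)), Or.inr ⟨?_, rfl⟩, ?_⟩
    · rw [add_assoc _ (single r _), ← single_add]
      simp only [show σ r - (i + 1) + 1 = σ r - i by omega]
    · simp only [add_smul, one_smul]
      abel
  · left
    simp [hδ]

theorem impl_clearReg (r : ℕ) : Impl regStore fun σ (x : Unit × _) => x.2 = σ.erase r :=
  (impl_drainReg r 0 rfl).mono fun σ x h => by simpa using h

theorem impl_clearRegs (b k : ℕ) : Impl regStore fun σ (x : Unit × _) =>
    ∀ r, x.2 r = if b ≤ r ∧ r < b + k then 0 else σ r := by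
  induction k with
  | zero =>
    refine (Impl.pure ()).mono fun σ x h => Prod.ext rfl (Finsupp.ext fun r => ?_)
    rw [h r, if_neg (by omega)]
  | succ k ih =>
    refine ((impl_clearReg (b + k)).seq ih).mono fun σ x h =>
      ⟨σ.erase (b + k), rfl, fun r => ?_⟩
    rw [h r, Finsupp.erase_apply]
    split_ifs <;> first | rfl | omega

/-- Reading a register destroys it, so its content is drained into `o` and `t` together and then
returned from `t`. -/
theorem impl_copyReg (r o t : ℕ) (hro : r ≠ o) (hrt : r ≠ t) (hot : o ≠ t) :
    Impl regStore fun σ (x : Unit × _) => σ t = 0 ∧ x.2 = σ + single o (σ r) := by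
  refine ((impl_drainReg r (single o 1 + single t 1)
    (by simp [hro.symm, hrt.symm])).seq (impl_drainReg t (single r 1) (by simp [hrt]))).mono ?_
  rintro σ ⟨_, _⟩ ⟨h, rfl⟩
  refine ⟨σ.erase r + σ r • (single o 1 + single t 1), rfl, Finsupp.ext fun s => ?_⟩
  by_cases h1 : s = r
  · subst h1
    simp [hro, hrt.symm, h, hot.symm]
  · by_cases h3 : s = t
    · subst h3
      simp [h, hot.symm, hrt.symm]
    · simp [h1, h3, Finsupp.single_apply]

/-! ### Evaluation of primitive recursive functions on registers -/

/-- For all registers `inp i`, `o` below `b`, some machine adds the value of `f` at the contents of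
`inp` to the register `o`, provided that the registers from `b` on are zero. -/
def Evaluable {n : ℕ} (f : List.Vector ℕ n → ℕ) : Prop :=
  ∀ (inp : Fin n → ℕ) (o b : ℕ), (∀ i, inp i < b) → o < b → (∀ i, inp i ≠ o) →
    Impl regStore fun σ (x : Unit × _) =>
      (∀ r, b ≤ r → σ r = 0) ∧ x.2 = σ + single o (f (List.Vector.ofFn fun i => σ (inp i)))

/-- The value of `g i` is stored in register `b + i`, `f` is applied to these registers with scratch
space from `b + n` on, and they are then cleared. -/
theorem Evaluable.comp {m n : ℕ} {f : List.Vector ℕ n → ℕ} {g : Fin n → List.Vector ℕ m → ℕ}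
    (hf : Evaluable f) (hg : ∀ i, Evaluable (g i)) :
    Evaluable fun a => f (List.Vector.ofFn fun i => g i a) := by
  intro inp o b hinp ho hio
  have hstep : ∀ k ≤ n, Impl regStore fun σ (x : Unit × _) =>
      (∀ r, b ≤ r → σ r = 0) ∧ ∀ r, x.2 r = if h : b ≤ r ∧ r < b + k ∧ r - b < n then
        g ⟨r - b, h.2.2⟩ (List.Vector.ofFn fun i => σ (inp i)) else σ r := by
    intro k hk
    induction k with
    | zero =>
      refine (Impl.pure ()).mono fun σ x h => Prod.ext rfl (Finsupp.ext fun r => ?_)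
      rw [h.2 r, dif_neg (by omega)]
    | succ k ih =>
      refine ((ih (by omega)).seq (hg ⟨k, hk⟩ inp (b + k) (b + n)
        (fun i => (hinp i).trans_le (by omega)) (by omega)
        (fun i => by have := hinp i; omega))).mono ?_
      rintro σ ⟨_, τ⟩ ⟨h0, h⟩
      -- The store before stage `k` is the store `τ` after it with register `b + k` set back to its
      -- initial value, which is 0.
      have key : ∀ r, (τ.erase (b + k) + single (b + k) (σ (b + k))) r =
          if h : b ≤ r ∧ r < b + k ∧ r - b < n then
          g ⟨r - b, h.2.2⟩ (List.Vector.ofFn fun i => σ (inp i)) else σ r := by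
        intro r
        simp only [Finsupp.add_apply, Finsupp.erase_apply, Finsupp.single_apply]
        by_cases hr : r = b + k
        · subst hr; simp
        · rw [if_neg hr, if_neg (Ne.symm hr), add_zero, h r]
          by_cases h1 : b ≤ r ∧ r < b + k ∧ r - b < n
          · rw [dif_pos h1, dif_pos (by omega)]
          · rw [dif_neg h1, dif_neg (by omega)]
      refine ⟨τ.erase (b + k) + single (b + k) (σ (b + k)), ⟨h0, key⟩, fun r hr => ?_, ?_⟩
      · rw [key r, dif_neg (by omega), h0 r (by omega)]
      · have hin : ∀ i, (τ.erase (b + k) + single (b + k) (σ (b + k))) (inp i) = σ (inp i) := by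
          intro i
          have := hinp i
          rw [key, dif_neg (by omega)]
        simp only [hin]
        refine Finsupp.ext fun r => ?_
        rw [Finsupp.add_apply, key r, h r, Finsupp.single_apply]
        by_cases hr : b + k = r
        · subst hr
          rw [dif_pos (by omega), dif_neg (by omega), if_pos rfl, h0 _ (by omega)]
          simp
        · rw [if_neg hr, add_zero]
          by_cases h1 : b ≤ r ∧ r < b + k ∧ r - b < n
          · rw [dif_pos h1, dif_pos (by omega)]
          · rw [dif_neg h1, dif_neg (by omega)]
  refine ((hstep n le_rfl).seq ((hf (fun i => b + i) o (b + n) (fun i => by omega) (by omega)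
    (fun i => by omega)).seq (impl_clearRegs b n))).mono ?_
  rintro σ ⟨_, _⟩ ⟨h0, rfl⟩
  set v := List.Vector.ofFn fun i => σ (inp i) with hv
  let ρ : ℕ →₀ ℕ := ∑ i : Fin n, single (b + i) (g i v)
  have hρ : ∀ r, (σ + ρ) r = if h : b ≤ r ∧ r < b + n ∧ r - b < n then g ⟨r - b, h.2.2⟩ v
      else σ r := by
    intro r
    simp only [ρ, Finsupp.add_apply, Finsupp.finsetSum_apply, Finsupp.single_apply]
    split_ifs with h
    · rw [Finset.sum_eq_single ⟨r - b, h.2.2⟩, if_pos (by simp only; omega), h0 r h.1, zero_add]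
      · intro i _ hi
        refine if_neg fun h' => hi (Fin.ext ?_)
        simp only
        omega
      · simp
    · rw [Finset.sum_eq_zero, add_zero]
      intro i _
      exact if_neg (by omega)
  refine ⟨σ + ρ, ⟨h0, hρ⟩, _, ⟨fun r hr => ?_, rfl⟩, fun r => ?_⟩
  · rw [hρ, dif_neg (by omega), h0 r (by omega)]
  · have hg' : (fun i : Fin n => (σ + ρ) (b + i)) = fun i => g i v := by
      funext i
      rw [hρ, dif_pos (by omega)]
      simp
    simp only [hg']
    rw [Finsupp.add_apply σ, Finsupp.add_apply (σ + ρ), hρ r]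
    by_cases h1 : b ≤ r ∧ r < b + n
    · rw [if_pos h1, h0 r h1.1, zero_add, Finsupp.single_apply, if_neg (by omega)]
    · rw [if_neg h1, dif_neg (by omega)]

/-- Register `b` holds the current value of the recursion, `b + 1` the number of rounds left, `b +
2` the index of the round, and `b + 3` receives the next value. Scratch space starts at `b + 4`. -/
theorem Evaluable.prec {n : ℕ} {f : List.Vector ℕ n → ℕ} {g : List.Vector ℕ (n + 2) → ℕ}
    (hf : Evaluable f) (hg : Evaluable g) :
    Evaluable fun v : List.Vector ℕ (n + 1) =>
      v.head.rec (f v.tail) fun y IH => g (y ::ᵥ IH ::ᵥ v.tail) := by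
  intro inp o b hinp ho hio
  have hbody := ((hg (Fin.cons (b + 2) (Fin.cons b fun i => inp i.succ)) (b + 3) (b + 4)
    (by
      refine Fin.cases (by simp) (Fin.cases (by simp) fun i => ?_)
      have := hinp i.succ
      simp only [Fin.cons_succ]
      omega) (by omega)
    (by
      refine Fin.cases (by simp) (Fin.cases (by simp) fun i => ?_)
      have := hinp i.succ
      simp only [Fin.cons_succ]
      omega)).seq ((impl_clearReg b).seq ((impl_drainReg (b + 3) (single b 1)
        (by simp)).seq (impl_incReg (b + 2)))))
  refine ((hf (fun i => inp i.succ) b (b + 4) (fun i => (hinp _).trans_le (by omega)) (by omega)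
    (fun i => (hinp _).ne)).seq ((impl_copyReg (inp 0) (b + 1) (b + 4)
      (by have := hinp 0; omega) (by have := hinp 0; omega) (by omega)).seq
    (((impl_decReg (b + 1)).whileTrue hbody).seq ((impl_drainReg b (single o 1)
      (by simp [ho.ne])).seq (impl_clearReg (b + 2)))))).mono ?_
  rintro σ ⟨_, _⟩ ⟨h0, rfl⟩
  have hh : (List.Vector.ofFn fun i => σ (inp i)).head = σ (inp 0) := by simp
  have ht : (List.Vector.ofFn fun i => σ (inp i)).tail =
      List.Vector.ofFn fun i => σ (inp i.succ) := by simp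
  beta_reduce
  rw [hh, ht]
  set v := List.Vector.ofFn fun i => σ (inp i.succ) with hv
  set k := σ (inp 0) with hk
  let F : ℕ → ℕ := fun i => Nat.rec (f v) (fun y IH => g (y ::ᵥ IH ::ᵥ v)) i
  -- `a i` is the store after `i` rounds.
  let a : ℕ → ℕ →₀ ℕ := fun i => σ + single b (F i) + single (b + 1) (k - i) + single (b + 2) i
  have hσb := h0 b (by omega)
  have hσ1 := h0 (b + 1) (by omega)
  have hσ2 := h0 (b + 2) (by omega)
  have hσ3 := h0 (b + 3) (by omega)
  refine ⟨_, ⟨fun r hr => h0 r (by omega), rfl⟩, _, ⟨?_, rfl⟩, a k,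
    ⟨k, a, ?_, fun i hi => ?_, Or.inl ⟨?_, rfl⟩⟩, _, rfl, ?_⟩
  · simp [h0 (b + 4) (by omega)]
  · have := hinp 0
    have h' : (σ + single b (f v)) (inp 0) = k := by
      rw [Finsupp.add_apply, Finsupp.single_apply, if_neg (by omega), add_zero]
    rw [h']
    simp [a, F]
  · let τ := σ + single b (F i) + single (b + 1) (k - (i + 1)) + single (b + 2) i
    let τ' := τ + single (b + 3) (F (i + 1))
    refine ⟨τ, Or.inr ⟨?_, rfl⟩, τ', ⟨fun r hr => ?_, ?_⟩, τ'.erase b, rfl,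
      (τ'.erase b).erase (b + 3) + (τ'.erase b) (b + 3) • single b 1, rfl, ?_⟩
    · refine Finsupp.ext fun s => ?_
      simp only [a, τ, Finsupp.add_apply, Finsupp.single_apply]
      split_ifs <;> omega
    · simp only [τ, Finsupp.add_apply, Finsupp.single_apply, h0 r (by omega)]
      split_ifs <;> omega
    · have hv' : (List.Vector.ofFn fun j => (σ + single b (F i) + single (b + 1) (k - (i + 1)) +
          single (b + 2) i) ((Fin.cons (b + 2) (Fin.cons b fun i => inp i.succ) :
            Fin (n + 2) → ℕ) j)) = i ::ᵥ F i ::ᵥ v := by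
        rw [List.Vector.ofFn, List.Vector.ofFn]
        congr 1
        · simp [hσ2]
        · congr 1
          · simp [hσb]
          · rw [hv]
            congr 1
            funext j
            have := hinp j.succ
            simp only [Fin.cons_succ, Finsupp.add_apply, Finsupp.single_apply]
            split_ifs <;> omega
      simp only [τ, hv']
      rfl
    · refine Finsupp.ext fun s => ?_
      simp only [a, τ, τ', Finsupp.add_apply, Finsupp.single_apply,
        Finsupp.erase_apply, Finsupp.smul_apply, smul_eq_mul, mul_ite, mul_one, mul_zero]
      have hs := h0 s
      split_ifs <;> omega
  · simp [a, hσ1]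
  · refine Finsupp.ext fun s => ?_
    simp only [a, Finsupp.add_apply, Finsupp.single_apply,
        Finsupp.erase_apply, Finsupp.smul_apply, smul_eq_mul, mul_ite, mul_one, mul_zero]
    change _ + (if _ then F k else 0) = _
    have hs := h0 s
    split_ifs <;> omega

theorem evaluable_of_primrec' {n : ℕ} {f : List.Vector ℕ n → ℕ} (hf : Nat.Primrec' f) :
    Evaluable f := by
  induction hf with
  | zero =>
    intro inp o b _ _ _
    exact (Impl.pure ()).mono fun s x h => Prod.ext rfl (by simpa using h.2)
  | succ =>
    intro inp o b hinp ho hio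
    refine ((impl_copyReg (inp 0) o b (hio 0) (hinp 0).ne ho.ne).seq (impl_incReg o)).mono ?_
    rintro σ ⟨_, _⟩ ⟨h0, rfl⟩
    refine ⟨_, ⟨h0 b le_rfl, rfl⟩, ?_⟩
    simp [single_add, add_assoc]
  | get i =>
    intro inp o b hinp ho hio
    refine (impl_copyReg (inp i) o b (hio i) (hinp i).ne ho.ne).mono ?_
    rintro σ ⟨_, _⟩ ⟨h0, rfl⟩
    exact ⟨h0 b le_rfl, by simp⟩
  | comp g _ _ hf hg => exact hf.comp hg
  | prec _ _ hf hg => exact hf.prec hg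

/-! ### The search machine and the undecidable problem -/

/-- A two-counter machine that halts if `g n m = 0` for some `m`, and whose first counter is
unbounded otherwise. -/
theorem exists_search_machine {g : ℕ → ℕ → ℕ} (hg : Primrec₂ g) (hle : ∀ n m, g n m ≤ 1) :
    ∃ (Q : Type) (_ : Finite Q) (M : CounterMachine Q Unit) (q₀ : Q) (c : ℕ), ∀ n,
      ((∃ m, g n m = 0) → ∃ s, M.Reaches (Sum.inl q₀, pairStore (c ^ n, 0)) (Sum.inr (), s)) ∧
      ((¬ ∃ m, g n m = 0) → ∀ B, ∃ d, M.Reaches (Sum.inl q₀, pairStore (c ^ n, 0)) d ∧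
        B < d.2 0) := by
  -- Register 0 holds `n`, register 1 the candidate `m`, and register 2 receives `g n m`. Since this
  -- value is at most 1, one decrement both tests and clears it.
  have hev := evaluable_of_primrec' (Nat.Primrec'.prim_iff₂.2 hg) ![0, 1] 2 3
    (by decide) (by decide) (by decide)
  have hbody : Impl regStore fun σ (x : Option Unit × (ℕ →₀ ℕ)) => ∃ n m,
      σ = single 0 n + single 1 m ∧ ((g n m = 0 ∧ x = (some (), σ)) ∨
        (g n m = 1 ∧ x = (none, single 0 n + single 1 (m + 1)))) := by
    refine (hev.seq ((impl_decReg 2).bind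
      (R' := fun b σ x => bif b then (∃ t, t = σ + single 1 1 ∧ x = (none, t))
        else x = (some (), σ)) fun b => match b with
      | true => (impl_incReg 1).seq (Impl.pure none)
      | false => Impl.pure (some ()))).mono ?_
    rintro _ x ⟨n, m, rfl, ⟨h, rfl⟩ | ⟨h, rfl⟩⟩
    · refine ⟨single 0 n + single 1 m, ⟨fun r hr => ?_, ?_⟩, (false, _), Or.inl ⟨?_, rfl⟩, rfl⟩
      · simp only [Finsupp.add_apply, Finsupp.single_apply]
        split_ifs <;> omega
      · simp [h]
      · simp
    · refine ⟨single 0 n + single 1 m + single 2 1, ⟨fun r hr => ?_, ?_⟩,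
        (true, single 0 n + single 1 m), Or.inr ⟨rfl, rfl⟩, _, rfl, ?_⟩
      · simp only [Finsupp.add_apply, Finsupp.single_apply]
        split_ifs <;> omega
      · simp [h]
      · simp [single_add, add_assoc]
  obtain ⟨Q, hQ, M, q, h1, h2⟩ := hbody.exists_loop
  refine ⟨Q, hQ, M, q, Nat.nth Nat.Prime 0, fun n => ?_⟩
  have hinit : pairStore (Nat.nth Nat.Prime 0 ^ n, 0) = regStore (single 0 n + single 1 0) := by
    simp [regStore, regCode_single]
  have hreach : ∀ m, (∀ i < m, g n i ≠ 0) →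
      M.Reaches (Sum.inl q, pairStore (Nat.nth Nat.Prime 0 ^ n, 0))
        (Sum.inl q, regStore (single 0 n + single 1 m)) := by
    intro m
    induction m with
    | zero => intro _; rw [hinit]; exact Relation.ReflTransGen.refl
    | succ m ih =>
      intro h
      refine (ih fun i hi => h i (by omega)).trans (h1 _ _ ⟨n, m, rfl, Or.inr ⟨?_, rfl⟩⟩)
      have := h m (by omega)
      have := hle n m
      omega
  constructor
  · intro h
    classical
    exact ⟨_, (hreach (Nat.find h) fun i hi => Nat.find_min h hi).trans
      (h2 _ _ _ ⟨n, _, rfl, Or.inl ⟨Nat.find_spec h, rfl⟩⟩)⟩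
  · intro h B
    -- When candidate `B` is reached, the code contains the `B`-th power of the second prime and
    -- therefore exceeds `B`.
    refine ⟨_, hreach B fun i _ hi => h ⟨i, hi⟩, ?_⟩
    change B < regCode _
    rw [regCode_add, regCode_single 1]
    exact (Nat.lt_pow_self (Nat.prime_nth_prime 1).one_lt).trans_le
      (Nat.le_mul_of_pos_left _ (regCode_pos _))

end CounterMachine

/-- The halting problem as an unbounded search for a zero of a primitive recursive function. -/
theorem exists_primrec_search_not_computable : ∃ g : ℕ → ℕ → ℕ, Primrec₂ g ∧
    (∀ n m, g n m ≤ 1) ∧ ¬ ComputablePred fun n => ∃ m, g n m = 0 := by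
  -- `g n m` is 0 exactly if the `n`-th code, run on input 0 with evaluation bound `m`, yields a
  -- value.
  let g : ℕ → ℕ → ℕ := fun n m =>
    bif (Nat.Partrec.Code.evaln m (Denumerable.ofNat Nat.Partrec.Code n) 0).isSome then 0 else 1
  refine ⟨g, ?_, fun n m => ?_, fun h => ComputablePred.halting_problem 0 ?_⟩
  · exact Primrec.cond (Primrec.option_isSome.comp (Nat.Partrec.Code.primrec_evaln.comp
      ((Primrec.snd.pair ((Primrec.ofNat _).comp Primrec.fst)).pair (Primrec.const 0))))
      (Primrec.const 0) (Primrec.const 1)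
  · simp only [g]
    cases (Nat.Partrec.Code.evaln m (Denumerable.ofNat Nat.Partrec.Code n) 0).isSome <;> simp
  · refine (ComputablePred.computable_of_manyOneReducible
      ⟨Encodable.encode, Computable.encode, fun c => ?_⟩ h :
        ComputablePred fun c : Nat.Partrec.Code => (Nat.Partrec.Code.eval c 0).Dom)
    simp only [Part.dom_iff_mem, Nat.Partrec.Code.evaln_complete, g, Denumerable.ofNat_encode]
    constructor
    · rintro ⟨x, k, hk⟩
      exact ⟨k, by rw [Option.mem_def.1 hk]; rfl⟩
    · rintro ⟨k, hk⟩
      cases hx : Nat.Partrec.Code.evaln k c 0 with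
      | none => simp [hx] at hk
      | some x => exact ⟨x, k, hx⟩

/-! ## General facts on runs -/

namespace PTA

variable {k m : ℕ} {T : Type} [Semiring T] [LinearOrder T] {A : PTA k m} {γ : Fin m → ℕ}

theorem Run.append {s s' s'' : Config k T} {w w' : List (ℕ × T)} (h : A.Run γ s w s')
    (h' : A.Run γ s' w' s'') : A.Run γ s (w ++ w') s'' := by
  induction h with
  | nil => exact h'
  | cons hd ha _ ih => exact .cons hd ha (ih h')

/-- There is a computation from `s` to `s'`. -/
def Reach (A : PTA k m) (γ : Fin m → ℕ) (s s' : Config k T) : Prop := ∃ w, A.Run γ s w s'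

theorem Reach.trans {s s' s'' : Config k T} (h : A.Reach γ s s') (h' : A.Reach γ s' s'') :
    A.Reach γ s s'' := by
  obtain ⟨w, hw⟩ := h
  obtain ⟨w', hw'⟩ := h'
  exact ⟨_, hw.append hw'⟩

theorem Reach.invariant {P : Config k T → Prop}
    (hd : ∀ d s s', A.DelayStep γ d s s' → P s → P s')
    (ha : ∀ a s s', A.ActionStep γ a s s' → P s → P s') {s s' : Config k T}
    (h : A.Reach γ s s') (hs : P s) : P s' := by
  obtain ⟨w, hw⟩ := h
  induction hw with
  | nil => exact hs
  | cons h1 h2 _ ih => exact ih (ha _ _ _ h2 (hd _ _ _ h1 hs))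

/-- Words of the language are nonempty; as the initial location is not accepting, the empty
computation needs no separate treatment. -/
theorem language_nonempty_iff (h : A.1.init ∉ A.1.final) :
    (A.language T γ).Nonempty ↔
      ∃ s : Config k T, s.loc ∈ A.1.final ∧ A.Reach γ (A.initConfig T) s := by
  constructor
  · rintro ⟨w, _, s, hs, hw⟩
    exact ⟨s, hs, w, hw⟩
  · rintro ⟨s, hs, w, hw⟩
    refine ⟨w, ?_, s, hs, hw⟩
    rintro rfl
    cases hw
    exact h hs

theorem IsPlain.isState_iff (hA : A.IsPlain) (s : Config k T) :
    A.IsState γ s ↔ s.loc < A.1.numLocs := by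
  refine ⟨And.left, fun h => ⟨h, ?_⟩⟩
  have hlen : s.loc < A.1.invariants.length := by rwa [A.2.2.2.1]
  rw [PTA.invariant, List.getD_eq_getElem _ _ hlen, hA.1 _ (List.getElem_mem hlen)]
  intro c hc
  cases hc

/-- The configuration of the continuous-time semantics given by a discrete-time one. -/
def natConfig (s : Config k ℕ) : Config k NNReal := ⟨s.loc, fun x => s.val x⟩

theorem sat_natConfig {s : Config k ℕ} {g : Guard k m} (h : Guard.Sat s.val γ g) :
    Guard.Sat (natConfig s).val γ g := by
  intro c hc
  have := h c hc
  rcases c with ⟨x, op, b⟩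
  cases op <;> simpa [Cmp.Holds, natConfig] using this

theorem IsState.nat {s : Config k ℕ} (h : A.IsState γ s) : A.IsState γ (natConfig s) :=
  ⟨h.1, sat_natConfig h.2⟩

theorem Run.nat {s s' : Config k ℕ} {w : List (ℕ × ℕ)} (h : A.Run γ s w s') :
    A.Run γ (natConfig s) (w.map fun a => (a.1, (a.2 : NNReal))) (natConfig s') := by
  induction h with
  | nil => exact .nil _
  | @cons s s₁ s₂ _ a d w hd ha _ ih =>
    refine .cons (s₁ := natConfig s₁) ?_ ?_ ih
    · exact ⟨hd.1.nat, hd.2.1.nat, hd.2.2.1, fun x => by simp [natConfig, hd.2.2.2 x]⟩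
    · obtain ⟨h1, h2, t, ht, hs, hl, ht', hg, hr⟩ := ha
      refine ⟨h1.nat, h2.nat, t, ht, hs, hl, ht', sat_natConfig hg, fun x => ?_⟩
      simp only [natConfig, hr x]
      split_ifs <;> simp

/-- Every discrete run is a continuous one, so runs need only be constructed over `ℕ` and excluded
over `NNReal`. -/
theorem language_nat_nonempty (h : (A.language ℕ γ).Nonempty) : (A.language NNReal γ).Nonempty := by
  obtain ⟨w, hw, s, hs, hr⟩ := h
  refine ⟨w.map fun a => (a.1, (a.2 : NNReal)), fun h => hw (List.map_eq_nil_iff.1 h),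
    natConfig s, hs, ?_⟩
  have hi : A.initConfig NNReal = natConfig (A.initConfig ℕ) := by
    simp [initConfig, natConfig]
  rw [hi]
  exact hr.nat

end PTA

/-! ## Simulation of two-counter machines -/

/-- The resets that a clock has still to undergo in a simulation cycle: at the value of the
parameter and then at 1, only at the value of the parameter, only at 1, or none. -/
inductive Phase : Type
  | long | short | unit | done
  deriving DecidableEq

namespace Phase

instance : Finite Phase := by
  let f : Phase → Fin 4 := fun φ => match φ with
    | long => 0
    | short => 1
    | unit => 2
    | done => 3
  refine Finite.of_injective f ?_
  rintro (_ | _ | _ | _) (_ | _ | _ | _) h <;> simp_all [f]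

/-- The clock value at which the next reset takes place. -/
def bound : Phase → ℕ ⊕ Fin 1
  | long => .inr 0
  | short => .inr 0
  | unit => .inl 1
  | done => .inl 0

def next : Phase → Phase
  | long => unit
  | _ => done

/-- The number of pending resets. -/
def rank : Phase → ℕ
  | long => 2
  | short => 1
  | unit => 1
  | done => 0

/-- The duration of the phase for a clock that starts it with value 0. -/
def duration (p : ℕ) : Phase → ℕ
  | long => p + 1
  | short => p
  | unit => 1
  | done => 0

/-- A reset takes from the clock value exactly what it takes from the pending duration; hence clock
minus duration is unaffected by resets. -/
theorem duration_eq (γ : Fin 1 → ℕ) (φ : Phase) :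
    φ.duration (γ 0) = boundValue γ φ.bound + φ.next.duration (γ 0) := by
  cases φ <;> simp [duration, boundValue, bound, next]

theorem rank_next_lt {φ : Phase} (h : φ ≠ done) : φ.next.rank < φ.rank := by
  cases φ <;> simp_all [rank, next]

end Phase

namespace CounterInstr

variable {B : Type}

/-- The phases of the clocks at the beginning of the cycle that simulates an instruction. -/
def phases : CounterInstr B → Fin 3 → Phase
  | inc r _, i => if i = r.castSucc then .short else .long
  | dec r _ _, i => if i = r.castSucc then .long else .short

/-- The jump target after the cycle. -/
def next : CounterInstr B → B
  | inc _ a => a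
  | dec _ a _ => a

end CounterInstr

/-- The locations of the automaton that simulates a counter machine. -/
inductive SimLoc (Q : Type) : Type
  | start
  | overflow
  | control (o : Q ⊕ Unit)
  | cycle (q : Q) (φ : Fin 3 → Phase)

namespace SimLoc

variable {Q : Type}

instance [Finite Q] : Finite (SimLoc Q) := by
  let f : SimLoc Q → Option (Option ((Q ⊕ Unit) ⊕ Q × (Fin 3 → Phase))) := fun l =>
    match l with
    | start => none
    | overflow => some none
    | control o => some (some (.inl o))
    | cycle q φ => some (some (.inr (q, φ)))
  refine Finite.of_injective f ?_
  rintro (_ | _ | o | ⟨q, φ⟩) (_ | _ | o' | ⟨q', φ'⟩) h <;> simp_all [f]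

/-- A numbering of the locations. -/
noncomputable def code [Finite Q] (l : SimLoc Q) : ℕ := Finite.equivFin (SimLoc Q) l

variable [Finite Q]

theorem code_injective : Function.Injective (code : SimLoc Q → ℕ) :=
  Fin.val_injective.comp (Finite.equivFin (SimLoc Q)).injective

theorem code_lt (l : SimLoc Q) : l.code < Nat.card (SimLoc Q) := Fin.is_lt _

end SimLoc

open CounterMachine

/-! ### The simulating automaton -/

section Simulation

variable {Q : Type} [Finite Q]

/-- The transition from `l` to `l'` with guard `g` and reset set `R`. -/
noncomputable def simEdge (l : SimLoc Q) (g : Guard 3 1) (R : List (Fin 3)) (l' : SimLoc Q) :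
    Transition 3 1 := ⟨l.code, g, 0, R, l'.code⟩

/-- Start the simulation with the counter values `K` and `0`. -/
noncomputable def startEdge (q₀ : Q) (K : ℕ) : Transition 3 1 :=
  simEdge .start [⟨0, .eq, .inl K⟩] [1, 2] (.control (.inl q₀))

noncomputable def beginEdge (M : CounterMachine Q Unit) (q : Q) : Transition 3 1 :=
  simEdge (.control (.inl q)) [⟨2, .eq, .inl 0⟩] [] (.cycle q (M q).phases)

/-- Requiring clock 2 to be zero turns conserved differences into actual clock values, which cannot
be negative. -/
noncomputable def finishEdge (M : CounterMachine Q Unit) (q : Q) : Transition 3 1 :=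
  simEdge (.cycle q fun _ => .done) [⟨2, .eq, .inl 0⟩] [] (.control (M q).next)

/-- The jump of a decrement instruction in case that the counter is zero. -/
noncomputable def zeroEdges (M : CounterMachine Q Unit) (q : Q) : List (Transition 3 1) :=
  match M q with
  | .inc _ _ => []
  | .dec r _ b => [simEdge (.control (.inl q)) [⟨2, .eq, .inl 0⟩, ⟨r.castSucc, .eq, .inl 0⟩] []
      (.control b)]

/-- For a clock in phase `done` the edge resets a clock that is already zero and changes nothing. -/
noncomputable def resetEdge (x : Q × (Fin 3 → Phase) × Fin 3) : Transition 3 1 :=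
  simEdge (.cycle x.1 x.2.1) [⟨x.2.2, .eq, (x.2.1 x.2.2).bound⟩] [x.2.2]
    (.cycle x.1 (Function.update x.2.1 x.2.2 (x.2.1 x.2.2).next))

noncomputable def overflowEdge (x : (Q ⊕ Unit) × Fin 2) : Transition 3 1 :=
  simEdge (.control x.1) [⟨2, .eq, .inl 0⟩, ⟨x.2.castSucc, .gt, .inr 0⟩] [] .overflow

/-- A list of all elements of a finite type. -/
noncomputable def allOf (B : Type) [Finite B] : List B :=
  (@Finset.univ B (Fintype.ofFinite B)).toList

@[simp] theorem mem_allOf {B : Type} [Finite B] (b : B) : b ∈ allOf B := by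
  simp [allOf]

noncomputable def simEdges (M : CounterMachine Q Unit) : List (Transition 3 1) :=
  (allOf Q).map (beginEdge M) ++ (allOf Q).map (finishEdge M) ++
    (allOf Q).flatMap (zeroEdges M) ++ (allOf (Q × (Fin 3 → Phase) × Fin 3)).map resetEdge ++
    (allOf ((Q ⊕ Unit) × Fin 2)).map overflowEdge

theorem mem_simEdges {M : CounterMachine Q Unit} {t : Transition 3 1} :
    t ∈ simEdges M ↔ (∃ q, beginEdge M q = t) ∨ (∃ q, finishEdge M q = t) ∨
      (∃ q, t ∈ zeroEdges M q) ∨ (∃ x, resetEdge (Q := Q) x = t) ∨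
      (∃ x, overflowEdge (Q := Q) x = t) := by
  simp only [simEdges, List.mem_append, List.mem_map, List.mem_flatMap, mem_allOf, true_and,
    or_assoc]

/-- The automaton that simulates `M` from the control state `q₀` and the counter values `K`, `0`,
with accepting location `f`. -/
noncomputable def simRaw (M : CounterMachine Q Unit) (q₀ : Q) (f : SimLoc Q) (K : ℕ) :
    RawPTA 3 1 where
  numLetters := 1
  numLocs := Nat.card (SimLoc Q)
  init := (SimLoc.start : SimLoc Q).code
  final := [f.code]
  invariants := List.replicate (Nat.card (SimLoc Q)) []
  transitions := startEdge q₀ K :: simEdges M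

theorem simRaw_eq_simEdge {M : CounterMachine Q Unit} {q₀ : Q} {f : SimLoc Q} {K : ℕ}
    {t : Transition 3 1} (ht : t ∈ (simRaw M q₀ f K).transitions) :
    ∃ (l : SimLoc Q) (g : Guard 3 1) (R : List (Fin 3)) (l' : SimLoc Q), t = simEdge l g R l' := by
  rcases List.mem_cons.1 ht with rfl | ht
  · exact ⟨_, _, _, _, rfl⟩
  rcases mem_simEdges.1 ht with ⟨q, rfl⟩ | ⟨q, rfl⟩ | ⟨q, hq⟩ | ⟨q, rfl⟩ | ⟨q, rfl⟩
  · exact ⟨_, _, _, _, rfl⟩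
  · exact ⟨_, _, _, _, rfl⟩
  · unfold zeroEdges at hq
    split at hq
    · cases hq
    · exact ⟨_, _, _, _, List.mem_singleton.1 hq⟩
  · exact ⟨_, _, _, _, rfl⟩
  · exact ⟨_, _, _, _, rfl⟩

theorem simRaw_wellFormed (M : CounterMachine Q Unit) (q₀ : Q) (f : SimLoc Q) (K : ℕ) :
    (simRaw M q₀ f K).WellFormed := by
  refine ⟨SimLoc.code_lt _, ?_, List.length_replicate, ?_, ?_⟩
  · intro l hl
    rw [List.mem_singleton.1 hl]
    exact SimLoc.code_lt _
  · intro J hJ c hc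
    rw [List.eq_of_mem_replicate hJ] at hc
    cases hc
  · intro t ht
    obtain ⟨l, g, R, l', rfl⟩ := simRaw_eq_simEdge ht
    exact ⟨SimLoc.code_lt _, Nat.one_pos, SimLoc.code_lt _⟩

noncomputable def simPTA (M : CounterMachine Q Unit) (q₀ : Q) (f : SimLoc Q) (K : ℕ) : PTA 3 1 :=
  ⟨simRaw M q₀ f K, simRaw_wellFormed M q₀ f K⟩

theorem simPTA_isPlain (M : CounterMachine Q Unit) (q₀ : Q) (f : SimLoc Q) (K : ℕ) :
    (simPTA M q₀ f K).IsPlain :=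
  ⟨fun _ hJ => List.eq_of_mem_replicate hJ, rfl⟩

theorem mem_simPTA {M : CounterMachine Q Unit} {q₀ : Q} {f : SimLoc Q} {K : ℕ}
    {t : Transition 3 1} (ht : t ∈ simEdges M) : t ∈ (simPTA M q₀ f K).1.transitions :=
  List.mem_cons_of_mem _ ht

theorem simPTA_allParametric (M : CounterMachine Q Unit) (q₀ : Q) (f : SimLoc Q) (K : ℕ) :
    (simPTA M q₀ f K).AllParametric := fun x =>
  Or.inl ⟨resetEdge (q₀, fun _ => .short, x),
    mem_simPTA (mem_simEdges.2 (.inr (.inr (.inr (.inl ⟨_, rfl⟩))))),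
    _, List.mem_singleton_self _, rfl, 0, rfl⟩

/-- Only the guard of the start edge depends on `K`; all other data are constants. -/
theorem primrec_simPTA (M : CounterMachine Q Unit) (q₀ : Q) (f : SimLoc Q) :
    Primrec (simPTA M q₀ f) := by
  have hc : Primrec fun K : ℕ => (⟨0, .eq, .inl K⟩ : ClockConstraint 3 1) :=
    (Primrec.of_equiv_symm (e := ClockConstraint.equivProd 3 1)).comp
      ((Primrec.const (0 : Fin 3)).pair ((Primrec.const Cmp.eq).pair Primrec.sumInl))
  have ht : Primrec (startEdge q₀) :=
    (Primrec.of_equiv_symm (e := Transition.equivProd 3 1)).comp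
      ((Primrec.const _).pair ((Primrec.list_cons.comp hc (Primrec.const [])).pair
        ((Primrec.const 0).pair ((Primrec.const _).pair (Primrec.const _)))))
  have hA : Primrec (simRaw M q₀ f) :=
    (Primrec.of_equiv_symm (e := RawPTA.equivProd 3 1)).comp
      ((Primrec.const _).pair ((Primrec.const _).pair ((Primrec.const _).pair
        ((Primrec.const _).pair ((Primrec.const _).pair
          (Primrec.list_cons.comp ht (Primrec.const (simEdges M))))))))
  exact Primrec.subtype_mk (hp := RawPTA.primrecPred_wellFormed) hA

/-! ### Every run simulates the machine -/

/-- The property of the clock values in the locations that is preserved by all steps. -/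
def SimInv (M : CounterMachine Q Unit) (q₀ : Q) (K p : ℕ) (v : Fin 3 → NNReal) :
    SimLoc Q → Prop
  | .start => ∀ i, v i = v 2
  | .overflow => ∃ d, M.Reaches (.inl q₀, pairStore (K, 0)) d ∧ ∃ r, p < d.2 r
  | .control o => ∃ c, M.Reaches (.inl q₀, pairStore (K, 0)) (o, c) ∧
      ∀ r : Fin 2, (v r.castSucc : ℝ) - v 2 = c r
  | .cycle q φ => ∃ c, M.Reaches (.inl q₀, pairStore (K, 0)) (.inl q, c) ∧
      ∀ r : Fin 2, ((v r.castSucc : ℝ) - (φ r.castSucc).duration p) - (v 2 - (φ 2).duration p) =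
        c r - ((M q).phases r.castSucc).duration p + ((M q).phases 2).duration p

omit [Finite Q] in
theorem SimInv.delay {M : CounterMachine Q Unit} {q₀ : Q} {K p : ℕ} {v v' : Fin 3 → NNReal}
    {l : SimLoc Q} (h : SimInv M q₀ K p v l) (d : NNReal) (hv : ∀ i, v' i = v i + d) :
    SimInv M q₀ K p v' l := by
  cases l with
  | start => intro i; rw [hv, hv, h i]
  | overflow => exact h
  | control o =>
    obtain ⟨c, hc, h⟩ := h
    refine ⟨c, hc, fun r => ?_⟩
    rw [← h r, hv, hv]
    push_cast
    ring
  | cycle q φ =>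
    obtain ⟨c, hc, h⟩ := h
    refine ⟨c, hc, fun r => ?_⟩
    rw [← h r, hv, hv]
    push_cast
    ring

omit [Finite Q] in
/-- Completing the cycle of an instruction amounts to executing it. -/
theorem reaches_of_cycle {M : CounterMachine Q Unit} {c₀ : (Q ⊕ Unit) × (Fin 2 → ℕ)} {q : Q}
    {c : Fin 2 → ℕ} {p : ℕ} (h : M.Reaches c₀ (.inl q, c)) {v : Fin 2 → NNReal}
    (hv : ∀ r : Fin 2, (v r : ℝ) =
      c r - ((M q).phases r.castSucc).duration p + ((M q).phases 2).duration p) :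
    ∃ c' : Fin 2 → ℕ, M.Reaches c₀ ((M q).next, c') ∧ ∀ r, (v r : ℝ) = c' r := by
  have hs : M.Reaches c₀ ((M q).exec c) := h.tail ⟨q, rfl, rfl⟩
  have h2 : ∀ r : Fin 2, (2 : Fin 3) ≠ r.castSucc := by decide
  cases hM : M q with
  | inc r a =>
    rw [hM] at hs hv
    refine ⟨_, hs, fun r' => ?_⟩
    rw [hv r']
    by_cases hr : r' = r
    · subst hr; simp [CounterInstr.phases, Phase.duration, h2]; ring
    · simp [CounterInstr.phases, Phase.duration, h2, hr]
  | dec r a b =>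
    rw [hM] at hs hv
    -- With a zero counter the clock would have the value `p - (p + 1) = -1`.
    have hpos : c r ≠ 0 := by
      intro h0
      have := hv r
      simp only [CounterInstr.phases, Phase.duration, h2, h0, if_true, if_false] at this
      have hn := (v r).coe_nonneg
      push_cast at this
      linarith
    obtain ⟨n, hn⟩ := Nat.exists_eq_succ_of_ne_zero hpos
    simp only [CounterInstr.exec, if_neg hpos] at hs
    refine ⟨_, hs, fun r' => ?_⟩
    rw [hv r']
    by_cases hr : r' = r
    · subst hr; simp [CounterInstr.phases, Phase.duration, h2, hn]
    · simp [CounterInstr.phases, Phase.duration, h2, hr]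

theorem sat_nil {k m : ℕ} {T : Type} [Semiring T] [LinearOrder T] {v : Fin k → T}
    {γ : Fin m → ℕ} : Guard.Sat v γ [] ↔ True := by
  simp [Guard.Sat]

theorem sat_cons {k m : ℕ} {T : Type} [Semiring T] [LinearOrder T] {v : Fin k → T}
    {γ : Fin m → ℕ} {c : ClockConstraint k m} {g : Guard k m} :
    Guard.Sat v γ (c :: g) ↔
      c.op.Holds (v c.clock) (boundValue γ c.bound : T) ∧ Guard.Sat v γ g := by
  simp [Guard.Sat]

/-- Edges inside a cycle and into it preserve the conserved differences. The finishing edge and the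
zero jump each carry out one machine step, and the overflow edge witnesses a counter above the
parameter. -/
theorem SimInv.edge {M : CounterMachine Q Unit} {q₀ : Q} {f : SimLoc Q} {K : ℕ} {γ : Fin 1 → ℕ}
    {v v' : Fin 3 → NNReal} {t : Transition 3 1} (ht : t ∈ (simPTA M q₀ f K).1.transitions)
    (hg : Guard.Sat v γ t.guard) (hr₀ : ∀ x ∈ t.reset, v' x = 0)
    (hr : ∀ x, x ∉ t.reset → v' x = v x)
    (h : ∀ l : SimLoc Q, t.source = l.code → SimInv M q₀ K (γ 0) v l) (l' : SimLoc Q)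
    (hl' : t.target = l'.code) : SimInv M q₀ K (γ 0) v' l' := by
  rcases List.mem_cons.1 ht with rfl | ht
  · obtain rfl : _ = l' := SimLoc.code_injective hl'
    have hi : ∀ i, v i = v 2 := h _ rfl
    refine ⟨_, .refl, ?_⟩
    simp only [startEdge, simEdge, sat_cons, Cmp.Holds, boundValue] at hg hr hr₀
    have h0 : v' 0 = K := (hr 0 (by simp)).trans hg.1
    have h1 : v' 1 = 0 := hr₀ 1 (by simp)
    have h2 : v' 2 = 0 := hr₀ 2 (by simp)
    intro r
    fin_cases r
    · simp [pairStore, h0, h2]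
    · simp [pairStore, h1, h2]
  rcases mem_simEdges.1 ht with ⟨q, rfl⟩ | ⟨q, rfl⟩ | ⟨q, hq⟩ | ⟨⟨q, φ, i⟩, rfl⟩ | ⟨⟨o, r⟩, rfl⟩
  · obtain rfl : _ = l' := SimLoc.code_injective hl'
    obtain ⟨c, hc, hv⟩ := h _ rfl
    refine ⟨c, hc, fun r => ?_⟩
    rw [← hv r, hr _ List.not_mem_nil, hr _ List.not_mem_nil]
    ring
  · obtain rfl : _ = l' := SimLoc.code_injective hl'
    obtain ⟨c, hc, hv⟩ := h _ rfl
    simp only [finishEdge, simEdge, sat_cons, Cmp.Holds, boundValue] at hg hr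
    have h2 : v 2 = 0 := by simpa using hg.1
    obtain ⟨c', hc', h'⟩ := reaches_of_cycle (p := γ 0) hc (v := fun r => v r.castSucc) fun r => by
      rw [← hv r, h2]; simp [Phase.duration]
    refine ⟨c', hc', fun r => ?_⟩
    rw [← h' r, hr _ List.not_mem_nil, hr _ List.not_mem_nil, h2]
    simp
  · unfold zeroEdges at hq
    split at hq
    · cases hq
    · rename_i r a b hM
      obtain rfl := List.mem_singleton.1 hq
      obtain rfl : _ = l' := SimLoc.code_injective hl'
      obtain ⟨c, hc, hv⟩ := h _ rfl
      simp only [simEdge, sat_cons, Cmp.Holds, boundValue] at hg hr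
      have h2 : v 2 = 0 := by simpa using hg.1
      have h3 : v r.castSucc = 0 := by simpa using hg.2.1
      have hcr : c r = 0 := by
        have := hv r
        rw [h2, h3] at this
        simpa using this.symm
      refine ⟨c, hc.tail ⟨q, rfl, ?_⟩, fun r => ?_⟩
      · rw [hM]
        simp [CounterInstr.exec, hcr]
      · rw [← hv r, hr _ List.not_mem_nil, hr _ List.not_mem_nil]
  · obtain rfl : _ = l' := SimLoc.code_injective hl'
    obtain ⟨c, hc, hv⟩ := h _ rfl
    simp only [resetEdge, simEdge, sat_cons, Cmp.Holds] at hg hr hr₀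
    have key : ∀ j, (v' j : ℝ) -
        (Function.update φ i (φ i).next j).duration (γ 0) = v j - (φ j).duration (γ 0) := by
      intro j
      by_cases hj : j = i
      · subst hj
        rw [hr₀ j (List.mem_singleton_self _), hg.1, Function.update_self, Phase.duration_eq γ (φ j)]
        push_cast
        ring
      · rw [hr j (by simpa using hj), Function.update_of_ne hj]
    refine ⟨c, hc, fun r => ?_⟩
    rw [← hv r, key, key]
  · obtain rfl : _ = l' := SimLoc.code_injective hl'
    obtain ⟨c, hc, hv⟩ := h _ rfl
    simp only [overflowEdge, simEdge, sat_cons, Cmp.Holds, boundValue] at hg hr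
    have h2 : v 2 = 0 := by simpa using hg.1
    have h3 : (γ 0 : NNReal) < v r.castSucc := hg.2.1
    refine ⟨_, hc, r, ?_⟩
    have := hv r
    rw [h2] at this
    have h4 : ((γ 0 : NNReal) : ℝ) < v r.castSucc := h3
    simp only [NNReal.coe_zero, sub_zero] at this
    rw [this] at h4
    simpa using h4

theorem simInv_of_reach {M : CounterMachine Q Unit} {q₀ : Q} {f : SimLoc Q} {K : ℕ}
    {γ : Fin 1 → ℕ} {s : Config 3 NNReal}
    (h : (simPTA M q₀ f K).Reach γ ((simPTA M q₀ f K).initConfig NNReal) s) (l : SimLoc Q)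
    (hl : s.loc = l.code) : SimInv M q₀ K (γ 0) s.val l := by
  refine h.invariant (P := fun s => ∀ l : SimLoc Q, s.loc = l.code → SimInv M q₀ K (γ 0) s.val l)
    ?_ ?_ ?_ l hl
  · rintro d s s' ⟨_, _, hl, hv⟩ hs l h
    exact (hs l (hl ▸ h)).delay d hv
  · rintro a s s' ⟨_, _, t, ht, hsrc, _, htgt, hg, hr⟩ hs l h
    exact SimInv.edge ht hg (fun x hx => by rw [hr, if_pos hx])
      (fun x hx => by rw [hr, if_neg hx]) (fun l hl => hs l (hsrc ▸ hl)) l (htgt.trans h)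
  · intro l hl
    obtain rfl : _ = l := SimLoc.code_injective hl
    exact fun _ => rfl

/-! ### The machine is simulated in discrete time -/

section Completeness

variable {M : CounterMachine Q Unit} {q₀ : Q} {f : SimLoc Q} {K : ℕ} {γ : Fin 1 → ℕ}

theorem reach_of_edge {l l' : SimLoc Q} {g : Guard 3 1} {R : List (Fin 3)}
    (ht : simEdge l g R l' ∈ (simPTA M q₀ f K).1.transitions) {v v' : Fin 3 → ℕ} (d : ℕ)
    (hg : Guard.Sat (fun i => v i + d) γ g) (hv : ∀ i, v' i = if i ∈ R then 0 else v i + d) :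
    (simPTA M q₀ f K).Reach γ ⟨l.code, v⟩ ⟨l'.code, v'⟩ := by
  have hst : ∀ (l : SimLoc Q) (v : Fin 3 → ℕ), (simPTA M q₀ f K).IsState γ ⟨l.code, v⟩ :=
    fun l v => ((simPTA_isPlain M q₀ f K).isState_iff _).2 l.code_lt
  exact ⟨_, .cons (a := 0) (d := d) (s₁ := ⟨l.code, fun i => v i + d⟩)
    ⟨hst _ _, hst _ _, rfl, fun _ => rfl⟩
    ⟨hst _ _, hst _ _, _, ht, rfl, rfl, rfl, hg, hv⟩ (.nil _)⟩

/-- The schedule always performs the earliest pending reset, so no clock misses its reset value, and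
the number of pending resets decreases. Here `hv` is the conservation law with the target values
`c`, and `h2` forces clock 2 to be zero once all resets are done. -/
theorem reach_of_cycle (q : Q) (c : Fin 3 → ℕ) (hc : c 2 = 0) (φ : Fin 3 → Phase)
    (v : Fin 3 → ℕ) (hb : ∀ i, φ i ≠ .done → v i ≤ boundValue γ (φ i).bound)
    (h2 : v 2 ≤ (φ 2).duration (γ 0))
    (hv : ∀ i, v i + (φ 2).duration (γ 0) = c i + v 2 + (φ i).duration (γ 0)) :
    (simPTA M q₀ f K).Reach γ ⟨(SimLoc.cycle q φ).code, v⟩ ⟨(SimLoc.control (M q).next).code, c⟩ := by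
  induction hn : ∑ i, (φ i).rank using Nat.strong_induction_on generalizing φ v with
  | _ n ih =>
  by_cases hφ : ∀ i, φ i = .done
  · obtain rfl : φ = fun _ => .done := funext hφ
    simp only [Phase.duration, Nat.le_zero_eq, add_zero] at h2 hv
    refine reach_of_edge (mem_simPTA (mem_simEdges.2 (.inr (.inl ⟨q, rfl⟩)))) 0 ?_ ?_
    · simp [sat_cons, sat_nil, Cmp.Holds, h2, boundValue]
    · intro i
      rw [hv i, h2]
      simp
  · push Not at hφ
    obtain ⟨i₀, hi₀⟩ := hφ
    obtain ⟨i, hi, hmin⟩ := Finset.exists_min_image (Finset.univ.filter fun i => φ i ≠ .done)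
      (fun i => boundValue γ (φ i).bound - v i) ⟨i₀, by simpa using hi₀⟩
    simp only [Finset.mem_filter, Finset.mem_univ, true_and] at hi hmin
    have hbi := hb i hi
    set d := boundValue γ (φ i).bound - v i with hd
    have hdur := Phase.duration_eq γ (φ i)
    have hvi := hv i
    refine (reach_of_edge (v' := Function.update (fun j => v j + d) i 0)
      (mem_simPTA (mem_simEdges.2 (.inr (.inr (.inr (.inl ⟨(q, φ, i), rfl⟩)))))) d ?_ ?_).trans
      (ih _ ?_ (Function.update φ i (φ i).next) _ ?_ ?_ ?_ rfl)
    · simp only [sat_cons, sat_nil, Cmp.Holds, and_true, Nat.cast_id]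
      omega
    · intro j
      by_cases hj : j = i
      · subst hj; simp
      · simp [hj]
    · rw [← hn]
      refine Finset.sum_lt_sum (fun j _ => ?_) ⟨i, Finset.mem_univ _, ?_⟩
      · by_cases hj : j = i
        · subst hj; simpa using (Phase.rank_next_lt hi).le
        · simp [hj]
      · simpa using Phase.rank_next_lt hi
    · intro j hj
      by_cases hji : j = i
      · subst hji; simp
      · rw [Function.update_of_ne hji] at hj ⊢
        rw [Function.update_of_ne hji]
        have := hb j hj
        have := hmin j hj
        omega
    · by_cases h2i : 2 = i
      · rw [h2i]; simp
      -- By `hv`, `v 2 + d` equals the duration of `φ 2` minus `c i` and minus the duration of `(φ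
      -- i).next`; so the target being nonnegative keeps clock 2 from running late.
      · rw [Function.update_of_ne h2i, Function.update_of_ne h2i]
        omega
    · intro j
      have hvj := hv j
      by_cases h2i : 2 = i
      · subst h2i
        by_cases hj : j = 2
        · subst hj; simp [hc]
        · simp only [Function.update_self, Function.update_of_ne hj]
          omega
      · by_cases hj : j = i
        · subst hj
          simp only [Function.update_self, Function.update_of_ne h2i]
          omega
        · simp only [Function.update_of_ne h2i, Function.update_of_ne hj]
          omega

/-- The clock values that represent the values of the counters. -/
def counterVal (c : Fin 2 → ℕ) : Fin 3 → ℕ := ![c 0, c 1, 0]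

theorem counterVal_castSucc (c : Fin 2 → ℕ) (r : Fin 2) : counterVal c r.castSucc = c r := by
  fin_cases r <;> rfl

theorem counterVal_two (c : Fin 2 → ℕ) : counterVal c 2 = 0 := rfl

/-- All first resets take place at the parameter, so `hc` says that no clock has passed its reset
value at the start. -/
theorem reach_of_begin (q : Q) (c c' : Fin 2 → ℕ) (hc : ∀ r, c r ≤ γ 0)
    (h : ∀ r : Fin 2, c r + ((M q).phases 2).duration (γ 0) =
      c' r + ((M q).phases r.castSucc).duration (γ 0)) :
    (simPTA M q₀ f K).Reach γ ⟨(SimLoc.control (.inl q)).code, counterVal c⟩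
      ⟨(SimLoc.control (M q).next).code, counterVal c'⟩ := by
  refine (reach_of_edge (v' := counterVal c)
    (mem_simPTA (mem_simEdges.2 (.inl ⟨q, rfl⟩))) 0 ?_ ?_).trans
    (reach_of_cycle q _ rfl _ _ ?_ (Nat.zero_le _) ?_)
  · simp [sat_cons, sat_nil, Cmp.Holds, boundValue, counterVal_two]
  · simp
  · intro i _
    have hγ : boundValue γ ((M q).phases i).bound = γ 0 := by
      cases M q with
      | inc r a => simp only [CounterInstr.phases]; split_ifs <;> rfl
      | dec r a b => simp only [CounterInstr.phases]; split_ifs <;> rfl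
    rw [hγ]
    induction i using Fin.lastCases with
    | last => exact Nat.zero_le _
    | cast r => rw [counterVal_castSucc]; exact hc r
  · intro i
    rw [counterVal_two, add_zero]
    induction i using Fin.lastCases with
    | last => rfl
    | cast r => rw [counterVal_castSucc, counterVal_castSucc]; exact h r

theorem reach_of_step {d d' : (Q ⊕ Unit) × (Fin 2 → ℕ)} (h : M.Step d d')
    (hd : ∀ r, d.2 r ≤ γ 0) :
    (simPTA M q₀ f K).Reach γ ⟨(SimLoc.control d.1).code, counterVal d.2⟩
      ⟨(SimLoc.control d'.1).code, counterVal d'.2⟩ := by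
  obtain ⟨_, c⟩ := d
  obtain ⟨q, rfl, rfl⟩ := h
  have h2 : ∀ r : Fin 2, (2 : Fin 3) ≠ r.castSucc := by decide
  have hbegin := fun c' => reach_of_begin (M := M) (q₀ := q₀) (f := f) (K := K) q c c' hd
  cases hM : M q with
  | inc r a =>
    rw [hM] at hbegin
    refine hbegin _ fun r' => ?_
    by_cases hr : r' = r
    · subst hr; simp [CounterInstr.phases, Phase.duration, h2, CounterInstr.exec]; ring
    · simp [CounterInstr.phases, Phase.duration, h2, hr, CounterInstr.exec]
  | dec r a b =>
    rw [hM] at hbegin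
    by_cases h0 : c r = 0
    · simp only [CounterInstr.exec, if_pos h0]
      refine reach_of_edge (R := [])
        (g := [⟨2, .eq, .inl 0⟩, ⟨r.castSucc, .eq, .inl 0⟩])
        (mem_simPTA (mem_simEdges.2 (.inr (.inr (.inl ⟨q, ?_⟩))))) 0 ?_ ?_
      · simp [zeroEdges, hM]
      · simp [sat_cons, sat_nil, Cmp.Holds, boundValue, counterVal_two, counterVal_castSucc, h0]
      · simp
    · simp only [CounterInstr.exec, if_neg h0]
      refine hbegin _ fun r' => ?_
      by_cases hr : r' = r
      · subst hr; simp [CounterInstr.phases, Phase.duration, h2]; omega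
      · simp [CounterInstr.phases, Phase.duration, h2, hr]

theorem reach_overflow {d : (Q ⊕ Unit) × (Fin 2 → ℕ)} {r : Fin 2} (h : γ 0 < d.2 r) :
    (simPTA M q₀ f K).Reach γ ⟨(SimLoc.control d.1).code, counterVal d.2⟩
      ⟨(SimLoc.overflow : SimLoc Q).code, counterVal d.2⟩ := by
  refine reach_of_edge (mem_simPTA (mem_simEdges.2 (.inr (.inr (.inr (.inr ⟨(d.1, r), rfl⟩))))))
    0 ?_ ?_
  · simpa [sat_cons, sat_nil, Cmp.Holds, boundValue, counterVal_two, counterVal_castSucc] using h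
  · simp

/-- The machine is followed step by step; a step that cannot be simulated starts with a counter
above the parameter, and then the overflow edge is enabled. -/
theorem reach_or_overflow {d : (Q ⊕ Unit) × (Fin 2 → ℕ)}
    (h : M.Reaches (.inl q₀, pairStore (K, 0)) d) :
    (simPTA M q₀ f K).Reach γ ((simPTA M q₀ f K).initConfig ℕ)
      ⟨(SimLoc.control d.1).code, counterVal d.2⟩ ∨
    ∃ v, (simPTA M q₀ f K).Reach γ ((simPTA M q₀ f K).initConfig ℕ)
      ⟨(SimLoc.overflow : SimLoc Q).code, v⟩ := by
  induction h with
  | refl =>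
    left
    refine reach_of_edge (l := .start) List.mem_cons_self K ?_ ?_
    · simp [sat_cons, sat_nil, Cmp.Holds, boundValue]
    · intro i
      fin_cases i <;> simp [counterVal, pairStore]
  | @tail d d' _ hd ih =>
    rcases ih with h | h
    · by_cases hp : ∀ r, d.2 r ≤ γ 0
      · exact .inl (h.trans (reach_of_step hd hp))
      · push Not at hp
        obtain ⟨r, hr⟩ := hp
        exact .inr ⟨_, h.trans (reach_overflow hr)⟩
    · exact .inr h

end Completeness

/-! ### The two problems for the simulating automaton -/

variable {M : CounterMachine Q Unit} {q₀ : Q} {K : ℕ}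

theorem simPTA_language_nonempty_iff {f : SimLoc Q} (hf : f ≠ .start) {T : Type} [Semiring T]
    [LinearOrder T] (γ : Fin 1 → ℕ) :
    ((simPTA M q₀ f K).language T γ).Nonempty ↔ ∃ v,
      (simPTA M q₀ f K).Reach γ ((simPTA M q₀ f K).initConfig T) ⟨f.code, v⟩ := by
  rw [PTA.language_nonempty_iff]
  · constructor
    · rintro ⟨⟨l, v⟩, hl, h⟩
      obtain rfl : l = f.code := List.mem_singleton.1 hl
      exact ⟨v, h⟩
    · rintro ⟨v, h⟩
      exact ⟨_, List.mem_singleton_self _, h⟩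
  · intro h
    exact hf (SimLoc.code_injective (List.mem_singleton.1 h)).symm

/-- A halting computation has bounded counters, and a parameter equal to such a bound admits the
whole simulation; the converse is soundness. The hypotheses `h₁` and `h₂` place the semantics
between discrete and continuous time. -/
theorem simPTA_reachability_iff {T : Type} [Semiring T] [LinearOrder T]
    (h₁ : ∀ (A : PTA 3 1) γ, (A.language ℕ γ).Nonempty → (A.language T γ).Nonempty)
    (h₂ : ∀ (A : PTA 3 1) γ, (A.language T γ).Nonempty → (A.language NNReal γ).Nonempty) :
    (simPTA M q₀ (.control (.inr ())) K).Reachability T ↔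
      ∃ s, M.Reaches (.inl q₀, pairStore (K, 0)) (.inr (), s) := by
  constructor
  · rintro ⟨γ, h⟩
    obtain ⟨v, hv⟩ := (simPTA_language_nonempty_iff (by simp) γ).1 (h₂ _ _ h)
    obtain ⟨c, hc, _⟩ := simInv_of_reach hv _ rfl
    exact ⟨c, hc⟩
  · rintro ⟨s, hs⟩
    obtain ⟨B, hB⟩ := hs.exists_bound
    refine ⟨fun _ => B, h₁ _ _ ((simPTA_language_nonempty_iff (by simp) _).2 ?_)⟩
    rcases reach_or_overflow (f := .control (.inr ())) (γ := fun _ => B) hs with h | ⟨v, w, hw⟩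
    · exact ⟨_, h⟩
    -- By soundness, an overflow would exhibit a counter above the bound `B`.
    · obtain ⟨d, hd, r, hr⟩ := simInv_of_reach (l := .overflow)
        (s := PTA.natConfig ⟨SimLoc.overflow.code, v⟩)
        (by have := hw.nat; exact ⟨_, by simpa [PTA.initConfig, PTA.natConfig] using this⟩) rfl
      exact absurd (hB d hd r) (Nat.not_le.2 hr)

/-- A safe parameter bounds the counters, which by `hM` forces halting; conversely, a bound on the
counters of a halting computation is a safe parameter. -/
theorem simPTA_safety_iff {T : Type} [Semiring T] [LinearOrder T]
    (h₁ : ∀ (A : PTA 3 1) γ, (A.language ℕ γ).Nonempty → (A.language T γ).Nonempty)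
    (h₂ : ∀ (A : PTA 3 1) γ, (A.language T γ).Nonempty → (A.language NNReal γ).Nonempty)
    (hM : (¬ ∃ s, M.Reaches (.inl q₀, pairStore (K, 0)) (.inr (), s)) → ∀ B, ∃ d,
      M.Reaches (.inl q₀, pairStore (K, 0)) d ∧ B < d.2 0) :
    (simPTA M q₀ .overflow K).Safety T ↔
      ∃ s, M.Reaches (.inl q₀, pairStore (K, 0)) (.inr (), s) := by
  constructor
  · rintro ⟨γ, h⟩
    by_contra hn
    obtain ⟨d, hd, hB⟩ := hM hn (γ 0)
    refine Set.nonempty_iff_ne_empty.1 (h₁ _ _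
      ((simPTA_language_nonempty_iff (by simp) γ).2 ?_)) h
    rcases reach_or_overflow (f := .overflow) (γ := γ) hd with h | h
    · exact ⟨_, h.trans (reach_overflow hB)⟩
    · exact h
  · rintro ⟨s, hs⟩
    obtain ⟨B, hB⟩ := hs.exists_bound
    refine ⟨fun _ => B, Set.not_nonempty_iff_eq_empty.1 fun h => ?_⟩
    obtain ⟨v, hv⟩ := (simPTA_language_nonempty_iff (by simp) _).1 (h₂ _ _ h)
    obtain ⟨d, hd, r, hr⟩ := simInv_of_reach hv _ rfl
    exact absurd (hB d hd r) (Nat.not_le.2 hr)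

end Simulation

/-! ### Undecidability by reduction -/

/-- An undecidable set reduces to both problems for plain automata with three parametric clocks, in
a semantics between the discrete-time and the continuous-time semantics. -/
theorem exists_not_computable_reduction {T : Type} [Semiring T] [LinearOrder T]
    (h₁ : ∀ (A : PTA 3 1) γ, (A.language ℕ γ).Nonempty → (A.language T γ).Nonempty)
    (h₂ : ∀ (A : PTA 3 1) γ, (A.language T γ).Nonempty → (A.language NNReal γ).Nonempty) :
    ∃ (S : ℕ → Prop) (F G : ℕ → PTA 3 1), ¬ ComputablePred S ∧ Primrec F ∧ Primrec G ∧
      (∀ n, (F n).AllParametric ∧ (F n).IsPlain) ∧ (∀ n, (G n).AllParametric ∧ (G n).IsPlain) ∧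
      (∀ n, (F n).Reachability T ↔ S n) ∧ ∀ n, (G n).Safety T ↔ S n := by
  obtain ⟨g, hg, hle, hS⟩ := exists_primrec_search_not_computable
  obtain ⟨Q, _, M, q₀, c, hM⟩ := exists_search_machine hg hle
  -- Without a zero of `g n` the first counter is unbounded, which is impossible for a halting
  -- computation.
  have hiff : ∀ n, (∃ s, M.Reaches (.inl q₀, pairStore (c ^ n, 0)) (.inr (), s)) ↔
      ∃ m, g n m = 0 := by
    refine fun n => ⟨fun ⟨s, hs⟩ => ?_, (hM n).1⟩
    by_contra hn
    obtain ⟨B, hB⟩ := hs.exists_bound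
    obtain ⟨d, hd, hlt⟩ := (hM n).2 hn B
    exact absurd (hB d hd 0) (Nat.not_le.2 hlt)
  have hpow : Primrec fun n => c ^ n :=
    (Primrec.nat_rec₁ 1 (Primrec.nat_mul.comp₂ Primrec₂.right (Primrec₂.const c))).of_eq fun n => by
      induction n with
      | zero => rfl
      | succ n ih => rw [pow_succ, ← ih]
  refine ⟨_, fun n => simPTA M q₀ (.control (.inr ())) (c ^ n),
    fun n => simPTA M q₀ .overflow (c ^ n), hS, (primrec_simPTA _ _ _).comp hpow,
    (primrec_simPTA _ _ _).comp hpow, fun n => ⟨simPTA_allParametric _ _ _ _, simPTA_isPlain _ _ _ _⟩,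
    fun n => ⟨simPTA_allParametric _ _ _ _, simPTA_isPlain _ _ _ _⟩,
    fun n => (simPTA_reachability_iff h₁ h₂).trans (hiff n),
    fun n => (simPTA_safety_iff h₁ h₂ fun h => (hM n).2 (by rwa [hiff] at h)).trans (hiff n)⟩

theorem reachability_safety_not_computable {T : Type} [Semiring T] [LinearOrder T]
    (h₁ : ∀ (A : PTA 3 1) γ, (A.language ℕ γ).Nonempty → (A.language T γ).Nonempty)
    (h₂ : ∀ (A : PTA 3 1) γ, (A.language T γ).Nonempty → (A.language NNReal γ).Nonempty) :
    ((¬ ComputablePred fun A : ThreeClockPTA => A.1.Reachability T) ∧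
      ¬ ComputablePred fun A : ThreeClockPTA => A.1.Safety T) ∧
    (¬ ComputablePred fun A : PlainThreeClockPTA => A.1.Reachability T) ∧
      ¬ ComputablePred fun A : PlainThreeClockPTA => A.1.Safety T := by
  obtain ⟨S, F, G, hS, hF, hG, hF', hG', hFS, hGS⟩ := exists_not_computable_reduction h₁ h₂
  have p₁ : ∀ {H : ℕ → PTA 3 1} (_ : Primrec H) (hH : ∀ n, (H n).AllParametric ∧ (H n).IsPlain),
      Computable fun n => (⟨H n, (hH n).1⟩ : ThreeClockPTA) := fun h _ =>
    (Primrec.subtype_mk (hp := PTA.primrecPred_allParametric) h).to_comp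
  have p₂ : ∀ {H : ℕ → PTA 3 1} (_ : Primrec H) (hH : ∀ n, (H n).AllParametric ∧ (H n).IsPlain),
      Computable fun n => (⟨H n, hH n⟩ : PlainThreeClockPTA) := fun h _ =>
    (Primrec.subtype_mk
      (hp := PTA.primrecPred_allParametric.and PTA.primrecPred_isPlain) h).to_comp
  refine ⟨⟨fun h => hS ?_, fun h => hS ?_⟩, fun h => hS ?_, fun h => hS ?_⟩
  · exact ComputablePred.computable_of_manyOneReducible
      ⟨_, p₁ hF hF', fun n => (hFS n).symm⟩ h
  · exact ComputablePred.computable_of_manyOneReducible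
      ⟨_, p₁ hG hG', fun n => (hGS n).symm⟩ h
  · exact ComputablePred.computable_of_manyOneReducible
      ⟨_, p₂ hF hF', fun n => (hFS n).symm⟩ h
  · exact ComputablePred.computable_of_manyOneReducible
      ⟨_, p₂ hG hG', fun n => (hGS n).symm⟩ h

theorem mainTheorem1 :
    ((¬ ComputablePred fun A : ThreeClockPTA => A.1.Reachability NNReal) ∧
      (¬ ComputablePred fun A : ThreeClockPTA => A.1.Safety NNReal) ∧
      (¬ ComputablePred fun A : ThreeClockPTA => A.1.Reachability ℕ) ∧
      (¬ ComputablePred fun A : ThreeClockPTA => A.1.Safety ℕ)) ∧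
    ((¬ ComputablePred fun A : PlainThreeClockPTA => A.1.Reachability NNReal) ∧
      (¬ ComputablePred fun A : PlainThreeClockPTA => A.1.Safety NNReal) ∧
      (¬ ComputablePred fun A : PlainThreeClockPTA => A.1.Reachability ℕ) ∧
      (¬ ComputablePred fun A : PlainThreeClockPTA => A.1.Safety ℕ)) := by
  obtain ⟨⟨h1, h2⟩, h3, h4⟩ := reachability_safety_not_computable (T := NNReal)
    (fun _ _ => PTA.language_nat_nonempty) fun _ _ h => h
  obtain ⟨⟨h5, h6⟩, h7, h8⟩ := reachability_safety_not_computable (T := ℕ)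
    (fun _ _ h => h) fun _ _ => PTA.language_nat_nonempty
  exact ⟨⟨h1, h2, h5, h6⟩, h3, h4, h7, h8⟩
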